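/- Let $\mu$ be a compactly supported Borel probability measure on $\mathbb R$, and for $\lambda\in\mathbb R$ put $e_\lambda(x)=e^{2\pi i\lambda x}$. For a countable set $\Lambda\subset\mathbb R$, $\Lambda$ is a spectrum of $\mu$ if $E(\Lambda)=(e_\lambda)_{\lambda\in\Lambda}$ is an orthonormal basis of $L^2(\mu)$. It is an R-spectrum of $\mu$ if $E(\Lambda)$ is a Riesz basis of $L^2(\mu)$, that is, a frame (there are $a,b>0$ with $a\|f\|^2\le\sum_{\lambda\in\Lambda}|\langle f,e_\lambda\rangle|^2\le b\|f\|^2$ for all $f\in L^2(\mu)$) and a basis (every $f\in L^2(\mu)$ has a unique expansion $f=\sum_{\lambda\in\Lambda}c_\lambda e_\lambda$). The measure $\mu$ is spectral (R-spectral) if it has a spectrum (an R-spectrum). It is singularly continuous if it has no atoms and is singular to Lebesgue measure. There exists a compactly supported, singularly continuous Borel probability measure on $\mathbb R$ that is R-spectral but not spectral. More precisely, let $n\in\mathbb N$ and let $A,B$ be finite sets of non-negative integers such that $A\oplus B=\{0,1,\dots,n-1\}$ (every element of $\{0,\dots,n-1\}$ is $a+b$ for exactly one pair $(a,b)\in A\times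 B$, and all these sums lie in $\{0,\dots,n-1\}$), $\gcd A=1$ and $\#A<n$. Then there is a unique Borel probability measure $\nu=\nu_{A,n}$ on $\mathbb R$ with $\nu(E)=\frac1{\#A}\sum_{a\in A}\nu(nE-a)$ for all Borel sets $E$. Let further $C$ be a finite set of non-negative integers and let $\eta=\sum_{c\in C}p_c\delta_c$ with weights $p_c>0$, $\sum_{c\in C}p_c=1$, that are not all equal. Then $\eta*\nu_{A,n}$ is a compactly supported, singularly continuous probability measure that is R-spectral but not spectral. -/

import Mathlib

open MeasureTheory

/-- The exponential function `x ↦ e^{2π i t x}`. -/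
noncomputable def expFun (t : ℝ) (x : ℝ) : ℂ :=
  Complex.exp (2 * Real.pi * Complex.I * t * x)

theorem expFun_memLp (μ : Measure ℝ) [IsFiniteMeasure μ] (t : ℝ) :
    MemLp (expFun t) 2 μ := by
  refine MemLp.of_bound (C := 1) ?_ (Filter.Eventually.of_forall fun x => ?_)
  · exact (by unfold expFun; fun_prop : Continuous (expFun t)).aestronglyMeasurable
  · have h : (2 * Real.pi * Complex.I * t * x : ℂ) = ((2 * Real.pi * t * x : ℝ) : ℂ) * Complex.I := by
      push_cast; ring
    rw [expFun, h, Complex.norm_exp_ofReal_mul_I]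

/-- The class of `x ↦ e^{2π i t x}` in `L²(μ)`. -/
noncomputable def expL2 (μ : Measure ℝ) [IsFiniteMeasure μ] (t : ℝ) : Lp ℂ 2 μ :=
  (expFun_memLp μ t).toLp (expFun t)

/-- `E(S) = {e^{2π i t x} : t ∈ S}` is an orthonormal basis of `L²(μ)`. -/
def IsSpectrum (μ : Measure ℝ) [IsFiniteMeasure μ] (S : Set ℝ) : Prop :=
  S.Countable ∧ ∃ b : HilbertBasis S ℂ (Lp ℂ 2 μ), ∀ t : S, b t = expL2 μ t

/-- `E(S)` is a Fourier frame of `L²(μ)`: there are `A, B > 0` such that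
`A ‖f‖² ≤ ∑_{t ∈ S} |⟨f, e_t⟩|² ≤ B ‖f‖²` for all `f ∈ L²(μ)`. -/
def IsFSpectrum (μ : Measure ℝ) [IsFiniteMeasure μ] (S : Set ℝ) : Prop :=
  S.Countable ∧ ∃ A B : ℝ, 0 < A ∧ 0 < B ∧ ∀ f : Lp ℂ 2 μ,
    Summable (fun t : S => ‖inner ℂ (expL2 μ t) f‖ ^ 2) ∧
    A * ‖f‖ ^ 2 ≤ ∑' t : S, ‖inner ℂ (expL2 μ t) f‖ ^ 2 ∧
    ∑' t : S, ‖inner ℂ (expL2 μ t) f‖ ^ 2 ≤ B * ‖f‖ ^ 2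

/-- `E(S)` is a Riesz basis of `L²(μ)`: it is a frame, and it is a basis, i.e. every `f ∈ L²(μ)`
has a unique expansion `f = ∑_{t ∈ S} c_t e_t`, convergent in `L²(μ)`. -/
def IsRSpectrum (μ : Measure ℝ) [IsFiniteMeasure μ] (S : Set ℝ) : Prop :=
  IsFSpectrum μ S ∧
    ∀ f : Lp ℂ 2 μ, ∃! c : S → ℂ, HasSum (fun t : S => c t • expL2 μ t) f

/-- `μ` is a spectral measure. -/
def IsSpectralMeasure (μ : Measure ℝ) [IsFiniteMeasure μ] : Prop :=
  ∃ S : Set ℝ, IsSpectrum μ S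

/-- `μ` is an R-spectral measure. -/
def IsRSpectralMeasure (μ : Measure ℝ) [IsFiniteMeasure μ] : Prop :=
  ∃ S : Set ℝ, IsRSpectrum μ S

/-- `μ` is singularly continuous: it has no atoms and is singular to Lebesgue measure. -/
def IsSingularlyContinuous (μ : Measure ℝ) : Prop :=
  (∀ x : ℝ, μ {x} = 0) ∧ μ.MutuallySingular volume

/-- `A ⊕ B = {0, …, n - 1}`: the sums `a + b` with `a ∈ A`, `b ∈ B` are exactly
`0, …, n - 1`, and each of these is represented only once. -/
def IsDirectSumRange (A B : Finset ℕ) (n : ℕ) : Prop :=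
  Set.InjOn (fun x : ℕ × ℕ => x.1 + x.2) (A ×ˢ B : Finset (ℕ × ℕ)) ∧
    (A ×ˢ B).image (fun x : ℕ × ℕ => x.1 + x.2) = Finset.range n

/-- The self-similarity relation `ν(E) = (1 / #A) ∑_{a ∈ A} ν(n E - a)` for all Borel sets `E`. -/
def IsSelfSimilar (A : Finset ℕ) (n : ℕ) (ν : Measure ℝ) : Prop :=
  ∀ E : Set ℝ, MeasurableSet E →
    ν E = (A.card : ENNReal)⁻¹ * ∑ a ∈ A, ν ((fun x : ℝ => n * x - a) '' E)

/-- The discrete measure `∑_{c ∈ C} p_c δ_c`. -/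
noncomputable def discreteMeasure (C : Finset ℕ) (p : ℕ → ℝ) : Measure ℝ :=
  ∑ c ∈ C, ENNReal.ofReal (p c) • Measure.dirac (c : ℝ)

instance (C : Finset ℕ) (p : ℕ → ℝ) : IsFiniteMeasure (discreteMeasure C p) := by
  refine ⟨?_⟩
  simp [discreteMeasure, ENNReal.sum_lt_top]

/-!
The non-spectrality of `μ = η * ν` rests on the disjointness of the translates `c + [0, 1)`,
`c ∈ C`: as `ν` lives on `[0, 1)`, `μ` has on `c + [0, 1)` the copy of `ν` scaled by `p c`. If
`E(S)` were an orthonormal basis of `L²(μ)`, Parseval's identity for the indicator function of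
`c + [0, 1)` would read `(p c)² ∑ |ν̂(t)|² = p c`, the sum being over `t ∈ S`, so that all `p c` would be equal
(`not_isSpectralMeasure_discreteMeasure_conv`).

For the R-spectrality it is enough that `ν` has a spectrum `Λ` consisting of integers, all of whose
translates are spectra as well. Then, for `#C` numbers `θ j ∈ [0, 1)` such that the matrix
`e^{2π i θ j c}` is invertible (a Vandermonde matrix), `⋃ j, (θ j + Λ)` is an R-spectrum of `μ`: as
`e^{2π i l c} = 1` for `l ∈ Λ`, the exponentials `e_{θ j + l}` are the images of the orthonormal
bases `(e_{θ j + l})_l` of the factors of `L²(ν)^C` under an isomorphism onto `L²(μ)`, which this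
matrix determines (`isRSpectralMeasure_discreteMeasure_conv`).

The spectrum of `ν` comes from a set `S` of `#A` integers such that the exponentials with
frequencies `s / n`, `s ∈ S`, are orthogonal on `A`. Its existence follows by induction from
de Bruijn's description of the tilings of `{0, …, n - 1}` (`IsDirectSumRange.exists_block`,
`IsDirectSumRange.exists_isDual`). The spectrum is the set of the integers with digits in `S` in
base `n` (`IsDual.exists_hilbertBasis`). It is orthogonal since
`ν̂(t) = m_A(t / n) ν̂(t / n)` with the `1`-periodic mask `m_A` of `A`. It is complete by Parseval's
identity for all exponentials, `∑ |ν̂(t + l)|² = 1`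
(`IsDual.hasSum_sq_norm_fourierMeasure`), a limit of the corresponding identities for the discrete
approximations of `ν`. The limit can be taken because the digits may be chosen in
`[-n / 2, n / 2]`, which keeps the relevant arguments in a compact part of `(-1, 1)`, and because
`ν̂` has no zeros there; this is where the complement `B` enters again, as `ν_A * ν_B` is Lebesgue
measure on `[0, 1]`.

Singular continuity of `ν` is elementary: the support of `ν` is covered by `#A < n` copies of
itself, each scaled by `1 / n`, and atoms are excluded by iterating the self-similarity relation.
-/

/-! ### Tilings of an initial segment of the natural numbers -/

theorem IsDirectSumRange.symm {A B : Finset ℕ} {n : ℕ} (h : IsDirectSumRange A B n) :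
    IsDirectSumRange B A n := by
  obtain ⟨h1, h2⟩ := h
  constructor
  · rintro ⟨b, a⟩ hx ⟨b', a'⟩ hy hxy
    simp only [Finset.coe_product, Set.mem_prod, Finset.mem_coe] at hx hy hxy
    have := @h1 (a, b) (by simp [hx]) (a', b') (by simp [hy]) (by simp only; omega)
    simp_all
  · rw [← h2]
    ext x
    simp only [Finset.mem_image, Finset.mem_product, Prod.exists]
    constructor
    · rintro ⟨b, a, h, rfl⟩; exact ⟨a, b, h.symm, add_comm _ _⟩
    · rintro ⟨b, a, h, rfl⟩; exact ⟨a, b, h.symm, add_comm _ _⟩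

theorem isDirectSumRange_iff {A B : Finset ℕ} {n : ℕ} :
    IsDirectSumRange A B n ↔
      (∀ a ∈ A, ∀ b ∈ B, ∀ a' ∈ A, ∀ b' ∈ B, a + b = a' + b' → a = a' ∧ b = b') ∧
      (∀ a ∈ A, ∀ b ∈ B, a + b < n) ∧ ∀ x < n, ∃ a ∈ A, ∃ b ∈ B, a + b = x := by
  constructor
  · rintro ⟨h1, h2⟩
    refine ⟨fun a ha b hb a' ha' b' hb' h => ?_, fun a ha b hb => ?_, fun x hx => ?_⟩
    · have := @h1 (a, b) (by simp [ha, hb]) (a', b') (by simp [ha', hb']) h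
      simpa using this
    · rw [← Finset.mem_range, ← h2]
      exact Finset.mem_image.2 ⟨(a, b), by simp [ha, hb], rfl⟩
    · rw [← Finset.mem_range, ← h2] at hx
      obtain ⟨⟨a, b⟩, h, rfl⟩ := Finset.mem_image.1 hx
      rw [Finset.mem_product] at h
      exact ⟨a, h.1, b, h.2, rfl⟩
  · rintro ⟨h1, h2, h3⟩
    constructor
    · rintro ⟨a, b⟩ hx ⟨a', b'⟩ hy hxy
      simp only [Finset.coe_product, Set.mem_prod, Finset.mem_coe] at hx hy hxy
      simpa using h1 a hx.1 b hx.2 a' hy.1 b' hy.2 hxy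
    · ext x
      simp only [Finset.mem_image, Finset.mem_product, Prod.exists, Finset.mem_range]
      constructor
      · rintro ⟨a, b, h, rfl⟩; exact h2 a h.1 b h.2
      · intro hx
        obtain ⟨a, ha, b, hb, h⟩ := h3 x hx
        exact ⟨a, b, ⟨ha, hb⟩, h⟩

theorem IsDirectSumRange.card_mul_card {A B : Finset ℕ} {n : ℕ} (h : IsDirectSumRange A B n) :
    A.card * B.card = n := by
  rw [← Finset.card_product, ← Finset.card_image_of_injOn h.1, h.2, Finset.card_range]

theorem IsDirectSumRange.zero_mem {A B : Finset ℕ} {n : ℕ} (h : IsDirectSumRange A B n)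
    (hn : 0 < n) : 0 ∈ A ∧ 0 ∈ B := by
  obtain ⟨a, ha, b, hb, hab⟩ := (isDirectSumRange_iff.1 h).2.2 0 hn
  obtain ⟨rfl, rfl⟩ : a = 0 ∧ b = 0 := by omega
  exact ⟨ha, hb⟩

/-- De Bruijn's reduction: a tiling `A ⊕ B = {0, …, n - 1}` in which `B` has a least positive
element `m > 1` is obtained from a tiling `A' ⊕ B' = {0, …, n' - 1}` as
`A = {0, …, m - 1} ⊕ m A'` and `B = m B'`, where `n = m n'`. The proof goes through the blocks
`{k m, …, k m + m - 1}` one after the other: each lies in `A` or is disjoint from it, and `B` can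
only contain its first element. -/
theorem IsDirectSumRange.exists_block {A B : Finset ℕ} {n m : ℕ} (h : IsDirectSumRange A B n)
    (hn : 0 < n) (hm : 1 < m) (hmB : m ∈ B) (hmin : ∀ b ∈ B, b ≠ 0 → m ≤ b) :
    ∃ (A' B' : Finset ℕ) (n' : ℕ), n = m * n' ∧ IsDirectSumRange A' B' n' ∧
      (∀ x, x ∈ A ↔ x / m ∈ A') ∧ ∀ x, x ∈ B ↔ m ∣ x ∧ x / m ∈ B' := by
  have hB0 : ∀ b ∈ B, b < m → b = 0 := fun b hb hbm => by
    by_contra h0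
    exact absurd (hmin b hb h0) (by omega)
  obtain ⟨h0A, h0B⟩ := h.zero_mem hn
  obtain ⟨huniq, hlt, hex⟩ := isDirectSumRange_iff.1 h
  have hmn : m < n := by have := hlt 0 h0A m hmB; omega
  have hsmall : ∀ j < m, j ∈ A := fun j hj => by
    obtain ⟨a, ha, b, hb, hab⟩ := hex j (by omega)
    obtain rfl := hB0 b hb (by omega)
    simpa [← hab] using ha
  have key : ∀ k, (∀ j < m, k * m + j ∈ A ↔ k * m ∈ A) ∧ ∀ j < m, k * m + j ∈ B → j = 0 := by
    intro k
    induction k using Nat.strong_induction_on with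
    | _ k ih =>
    rcases Nat.eq_zero_or_pos k with rfl | hk
    · refine ⟨fun j hj => ?_, fun j hj hjB => hB0 j (by simpa using hjB) hj⟩
      simp [h0A, hsmall j hj]
    have hkm : m ≤ k * m := Nat.le_mul_of_pos_left m hk
    by_cases hkA : k * m ∈ A
    · have hnoB : ∀ j < m, k * m + j ∉ B := by
        intro j hj hjB
        rcases Nat.eq_zero_or_pos j with rfl | hj0
        · have := huniq _ hkA 0 h0B 0 h0A (k * m) (by simpa using hjB) (by omega)
          omega
        · have := huniq _ hkA m hmB (m - j) (hsmall _ (by omega)) _ hjB (by omega)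
          omega
      refine ⟨fun j hj => ⟨fun _ => hkA, fun _ => ?_⟩, fun j hj hjB => absurd hjB (hnoB j hj)⟩
      obtain ⟨a, ha, b, hb, hab⟩ := hex (k * m + j) (by have := hlt _ hkA m hmB; omega)
      have hbk : b < k * m := by
        by_contra hc
        have := hnoB (b - k * m) (by omega)
        rw [Nat.add_sub_cancel' (by omega)] at this
        exact this hb
      by_cases hak : a < k * m
      · -- the first element of the block would have a second representation
        exfalso
        have ha1 := ih (a / m) ((Nat.div_lt_iff_lt_mul (by omega)).2 hak)
        have hb1 := ih (b / m) ((Nat.div_lt_iff_lt_mul (by omega)).2 hbk)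
        have ea : a / m * m + a % m = a := Nat.div_add_mod' a m
        have eb : b / m * m + b % m = b := Nat.div_add_mod' b m
        have hbm := hb1.2 (b % m) (Nat.mod_lt _ (by omega)) (by rwa [eb])
        have ha2 := (ha1.1 (a % m) (Nat.mod_lt _ (by omega))).1 (by rwa [ea])
        have hal := Nat.mod_lt a (show 0 < m by omega)
        have e1 : (a / m + b / m) * m + a % m = k * m + j := by
          rw [add_mul]; omega
        have e2 : a / m + b / m = k := by
          have h1 : ((a / m + b / m) * m + a % m) / m = a / m + b / m := by
            rw [mul_comm, Nat.mul_add_div (by omega), Nat.div_eq_of_lt hal, add_zero]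
          have h2 : (k * m + j) / m = k := by
            rw [mul_comm, Nat.mul_add_div (by omega), Nat.div_eq_of_lt hj, add_zero]
          rw [← h1, e1, h2]
        have e3 : a / m * m + b / m * m = k * m := by rw [← add_mul, e2]
        have e4 : b / m * m = b := by omega
        have := huniq _ ha2 b hb _ hkA 0 h0B (by omega)
        omega
      · have hb0 := hB0 b hb (by omega)
        subst hb0
        rw [← hab]; simpa using ha
    · by_cases hkB : k * m ∈ B
      · constructor
        · refine fun j hj => ⟨fun hjA => ?_, fun hc => absurd hc hkA⟩
          have := huniq _ hjA 0 h0B j (hsmall j hj) _ hkB (by omega)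
          omega
        · intro j hj hjB
          have := huniq 0 h0A _ hjB j (hsmall j hj) _ hkB (by omega)
          omega
      · -- either the block starts beyond `n`, or it is covered by the preceding blocks
        by_cases hkn : k * m < n
        · obtain ⟨a, ha, b, hb, hab⟩ := hex (k * m) hkn
          have hak : a < k * m := lt_of_le_of_ne (by omega) (fun e => hkA (e ▸ ha))
          have hbk : b < k * m := lt_of_le_of_ne (by omega) (fun e => hkB (e ▸ hb))
          have ha1 := ih (a / m) ((Nat.div_lt_iff_lt_mul (by omega)).2 hak)
          have hb1 := ih (b / m) ((Nat.div_lt_iff_lt_mul (by omega)).2 hbk)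
          have ea : a / m * m + a % m = a := Nat.div_add_mod' a m
          have eb : b / m * m + b % m = b := Nat.div_add_mod' b m
          have hbm := hb1.2 (b % m) (Nat.mod_lt _ (by omega)) (by rwa [eb])
          have hal := Nat.mod_lt a (show 0 < m by omega)
          have e1 : (a / m + b / m) * m + a % m = k * m := by
            rw [add_mul]; omega
          have e2 : a % m = 0 := by
            have := congrArg (· % m) e1
            simpa using this
          have hcov : ∀ j < m, a + j ∈ A := by
            intro j hj
            have h1 := ha1.1 j hj
            rw [show a / m * m = a by omega] at h1
            exact h1.2 ha
          constructor
          · refine fun j hj => ⟨fun hjA => ?_, fun hc => absurd hc hkA⟩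
            have := huniq _ hjA 0 h0B _ (hcov j hj) b hb (by omega)
            omega
          · intro j hj hjB
            have := huniq 0 h0A _ hjB _ (hcov j hj) b hb (by omega)
            omega
        · constructor
          · refine fun j hj => ⟨fun hjA => ?_, fun hc => absurd hc hkA⟩
            have := hlt _ hjA 0 h0B
            omega
          · intro j hj hjB
            have := hlt 0 h0A _ hjB
            omega
  have hdiv : ∀ x, x / m * m + x % m = x := fun x => Nat.div_add_mod' x m
  have hmod : ∀ x, x % m < m := fun x => Nat.mod_lt _ (by omega)
  have hAm : ∀ x, x ∈ A ↔ x / m * m ∈ A := fun x => by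
    have := (key (x / m)).1 (x % m) (hmod x)
    rwa [hdiv] at this
  have hBm : ∀ b ∈ B, b / m * m = b := fun b hb => by
    have h1 := (key (b / m)).2 (b % m) (hmod b) (by rwa [hdiv])
    have := hdiv b
    omega
  have hdvd : m ∣ n := by
    by_contra hnd
    have h1 : n % m ≠ 0 := fun e => hnd (Nat.dvd_of_mod_eq_zero e)
    have h2 := hdiv n
    obtain ⟨a, ha, b, hb, hab⟩ := hex (n / m * m) (by omega)
    have ha2 := (hAm a).1 ha
    have e1 := hBm b hb
    have h3 := (key (a / m)).1 (m - 1) (by omega)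
    have h4 := hlt _ (h3.2 ha2) b hb
    have h5 : a % m = 0 := by
      have : (a + b) % m = 0 := by rw [hab]; simp
      rw [← e1, Nat.add_mul_mod_self_right] at this
      exact this
    have h6 := hdiv a
    have h7 := hmod n
    omega
  obtain ⟨n', rfl⟩ := hdvd
  have hm0 : 0 < m := by omega
  refine ⟨A.image (· / m), B.image (· / m), n', rfl, ?_, fun x => ?_, fun x => ?_⟩
  · rw [isDirectSumRange_iff]
    simp only [Finset.forall_mem_image]
    refine ⟨fun a ha b hb a' ha' b' hb' hab => ?_, fun a ha b hb => ?_, fun x hx => ?_⟩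
    · have := huniq _ ((hAm a).1 ha) b hb _ ((hAm a').1 ha') b' hb' (by
        rw [← hBm b hb, ← hBm b' hb', ← add_mul, ← add_mul, hab])
      refine ⟨?_, by rw [this.2]⟩
      exact Nat.eq_of_mul_eq_mul_right hm0 this.1
    · have := hlt _ ((hAm a).1 ha) b hb
      rw [← hBm b hb, ← add_mul, mul_comm] at this
      exact lt_of_mul_lt_mul_left this (Nat.zero_le m)
    · obtain ⟨a, ha, b, hb, hab⟩ := hex (m * x) (Nat.mul_lt_mul_of_pos_left hx hm0)
      refine ⟨a / m, Finset.mem_image_of_mem _ ha, b / m, Finset.mem_image_of_mem _ hb, ?_⟩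
      rw [← Nat.add_div_of_dvd_left ⟨b / m, by rw [mul_comm]; exact (hBm b hb).symm⟩, hab,
        Nat.mul_div_cancel_left _ hm0]
  · rw [Finset.mem_image]
    constructor
    · exact fun hx => ⟨x, hx, rfl⟩
    · rintro ⟨y, hy, hyx⟩
      rw [hAm, ← hyx, ← hAm]
      exact hy
  · rw [Finset.mem_image]
    constructor
    · exact fun hx => ⟨⟨x / m, by rw [mul_comm]; exact (hBm x hx).symm⟩, x, hx, rfl⟩
    · rintro ⟨⟨k, rfl⟩, y, hy, hyx⟩
      rw [Nat.mul_div_cancel_left _ hm0] at hyx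
      rwa [← hyx, mul_comm, hBm y hy]

/-! ### Exponentials and the mask of a digit set -/

theorem continuous_expFun (t : ℝ) : Continuous (expFun t) := by unfold expFun; fun_prop

theorem norm_expFun (t x : ℝ) : ‖expFun t x‖ = 1 := by
  have h : (2 * Real.pi * Complex.I * t * x : ℂ) = ((2 * Real.pi * t * x : ℝ) : ℂ) * Complex.I := by
    push_cast; ring
  rw [expFun, h, Complex.norm_exp_ofReal_mul_I]

theorem expFun_add (s t x : ℝ) : expFun (s + t) x = expFun s x * expFun t x := by
  rw [expFun, expFun, expFun, ← Complex.exp_add]; congr 1; push_cast; ring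

theorem expFun_add_right (t x y : ℝ) : expFun t (x + y) = expFun t x * expFun t y := by
  rw [expFun, expFun, expFun, ← Complex.exp_add]; congr 1; push_cast; ring

theorem expFun_zero (x : ℝ) : expFun 0 x = 1 := by simp [expFun]

theorem expFun_zero_right (t : ℝ) : expFun t 0 = 1 := by simp [expFun]

theorem expFun_mul_comm (r t x : ℝ) : expFun (r * t) x = expFun t (r * x) := by
  rw [expFun, expFun]; congr 1; push_cast; ring

theorem conj_expFun (t x : ℝ) : (starRingEnd ℂ) (expFun t x) = expFun (-t) x := by
  rw [expFun, expFun, ← Complex.exp_conj]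
  congr 1
  simp only [map_mul, Complex.conj_ofReal, Complex.conj_I, map_ofNat, Complex.ofReal_neg]
  ring

theorem expFun_intCast (k m : ℤ) : expFun k m = 1 := by
  rw [expFun, Complex.exp_eq_one_iff]
  exact ⟨k * m, by push_cast; ring⟩

theorem expFun_one_right_eq_one_iff (t : ℝ) : expFun t 1 = 1 ↔ ∃ k : ℤ, t = k := by
  rw [expFun, Complex.exp_eq_one_iff]
  refine exists_congr fun k => ?_
  have h : (2 * Real.pi * Complex.I : ℂ) ≠ 0 := Complex.two_pi_I_ne_zero
  rw [show (2 * Real.pi * Complex.I * t * (1 : ℝ) : ℂ) = t * (2 * Real.pi * Complex.I) by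
    push_cast; ring, mul_left_inj' h]
  norm_cast

theorem expFun_pow (t x : ℝ) (k : ℕ) : expFun t x ^ k = expFun t (k * x) := by
  rw [expFun, expFun, ← Complex.exp_nat_mul]; congr 1; push_cast; ring

/-- The mask `t ↦ (1 / #A) ∑_{a ∈ A} e^{2π i a t}` of a digit set `A`: the Fourier transform of
the uniform distribution on `A`. -/
noncomputable def mask (A : Finset ℕ) (t : ℝ) : ℂ :=
  (A.card : ℂ)⁻¹ * ∑ a ∈ A, expFun t a

theorem mask_add_intCast (A : Finset ℕ) (t : ℝ) (k : ℤ) : mask A (t + k) = mask A t := by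
  rw [mask, mask]
  congr 1
  refine Finset.sum_congr rfl fun a _ => ?_
  have := expFun_intCast k a
  rw [Int.cast_natCast] at this
  rw [expFun_add, this, mul_one]

theorem mask_intCast {A : Finset ℕ} (hA : A.Nonempty) (k : ℤ) : mask A k = 1 := by
  rw [← zero_add (k : ℝ), mask_add_intCast, mask]
  have : (A.card : ℂ) ≠ 0 := by exact_mod_cast hA.card_ne_zero
  simp [expFun_zero, this]

theorem norm_mask_le_one (A : Finset ℕ) (t : ℝ) : ‖mask A t‖ ≤ 1 := by
  rw [mask, norm_mul, norm_inv, Complex.norm_natCast]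
  refine inv_mul_le_one_of_le₀ ?_ (Nat.cast_nonneg _)
  exact (norm_sum_le _ _).trans (by simp [norm_expFun])

theorem mask_range_mul (n : ℕ) (t : ℝ) :
    mask (Finset.range n) t * (n * (expFun t 1 - 1)) = expFun t n - 1 := by
  rcases Nat.eq_zero_or_pos n with rfl | hn
  · simp [expFun_zero_right]
  have h := geom_sum_mul (expFun t 1) n
  simp only [expFun_pow, mul_one] at h
  have hn0 : (n : ℂ) ≠ 0 := by exact_mod_cast hn.ne'
  rw [mask, ← h, Finset.card_range]
  field_simp

theorem mask_range_eq_zero {n : ℕ} {k : ℤ} (hn : 0 < n) (hk : ¬ (n : ℤ) ∣ k) :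
    mask (Finset.range n) (k / n) = 0 := by
  have hn0 : (n : ℝ) ≠ 0 := by exact_mod_cast hn.ne'
  have h := mask_range_mul n (k / n)
  have h1 : expFun (k / n) n = 1 := by
    rw [← mul_one (n : ℝ), ← expFun_mul_comm, mul_one, mul_div_cancel₀ _ hn0]
    simpa using expFun_intCast k 1
  rw [h1, sub_self] at h
  rcases mul_eq_zero.1 h with h | h
  · exact h
  · rcases mul_eq_zero.1 h with h | h
    · exact absurd h (by exact_mod_cast hn.ne')
    · exfalso
      obtain ⟨l, hl⟩ := (expFun_one_right_eq_one_iff _).1 (sub_eq_zero.1 h)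
      rw [div_eq_iff hn0] at hl
      exact hk ⟨l, by rw [mul_comm]; exact_mod_cast hl⟩

theorem mask_of_product (A B D : Finset ℕ)
    (hinj : Set.InjOn (fun x : ℕ × ℕ => x.1 + x.2) (A ×ˢ B : Finset (ℕ × ℕ)))
    (hD : (A ×ˢ B).image (fun x : ℕ × ℕ => x.1 + x.2) = D) (t : ℝ) :
    mask D t = mask A t * mask B t := by
  have hcard : D.card = A.card * B.card := by
    rw [← hD, Finset.card_image_of_injOn hinj, Finset.card_product]
  rw [mask, mask, mask, hcard, ← hD, Finset.sum_image hinj, Finset.sum_product]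
  simp only [Nat.cast_add, expFun_add_right, Nat.cast_mul, mul_inv]
  rw [mul_mul_mul_comm, Finset.sum_mul_sum]

theorem mask_image_mul {A : Finset ℕ} {m : ℕ} (hm : 0 < m) (t : ℝ) :
    mask (A.image (m * ·)) t = mask A (m * t) := by
  have hinj : Function.Injective (fun x : ℕ => m * x) := fun x y h =>
    Nat.eq_of_mul_eq_mul_left hm h
  rw [mask, mask, Finset.card_image_of_injective _ hinj, Finset.sum_image (hinj.injOn)]
  simp only [expFun_mul_comm, Nat.cast_mul]

/-- The mask of `{0, …, m - 1} ⊕ m A'`. -/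
theorem mask_block {A A' : Finset ℕ} {m : ℕ} (hm : 0 < m) (h : ∀ x, x ∈ A ↔ x / m ∈ A') (t : ℝ) :
    A.card = m * A'.card ∧ mask A t = mask (Finset.range m) t * mask A' (m * t) := by
  have hinj : Set.InjOn (fun x : ℕ × ℕ => x.1 + x.2)
      (A'.image (m * ·) ×ˢ Finset.range m : Finset (ℕ × ℕ)) := by
    rintro ⟨a, j⟩ hx ⟨b, i⟩ hy hxy
    simp only [Finset.coe_product, Set.mem_prod, Finset.mem_coe, Finset.mem_image,
      Finset.mem_range] at hx hy hxy
    obtain ⟨⟨a, -, rfl⟩, hj⟩ := hx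
    obtain ⟨⟨b, -, rfl⟩, hi⟩ := hy
    have h1 : (m * a + j) / m = a := by
      rw [Nat.mul_add_div hm, Nat.div_eq_of_lt hj, add_zero]
    have h2 : (m * b + i) / m = b := by
      rw [Nat.mul_add_div hm, Nat.div_eq_of_lt hi, add_zero]
    rw [hxy, h2] at h1
    subst h1
    simpa using hxy
  have himg : (A'.image (m * ·) ×ˢ Finset.range m).image (fun x : ℕ × ℕ => x.1 + x.2) = A := by
    ext x
    simp only [Finset.mem_image, Finset.mem_product, Prod.exists, Finset.mem_range]
    constructor
    · rintro ⟨a, j, ⟨⟨a, ha, rfl⟩, hj⟩, rfl⟩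
      rw [h, Nat.mul_add_div hm, Nat.div_eq_of_lt hj, add_zero]
      exact ha
    · intro hx
      exact ⟨m * (x / m), x % m, ⟨⟨x / m, (h x).1 hx, rfl⟩, Nat.mod_lt _ hm⟩, Nat.div_add_mod x m⟩
  constructor
  · rw [← himg, Finset.card_image_of_injOn hinj, Finset.card_product, Finset.card_range,
      Finset.card_image_of_injective _ (fun x y h => Nat.eq_of_mul_eq_mul_left hm h), mul_comm]
  · rw [mask_of_product _ _ _ hinj himg, mask_image_mul hm, mul_comm]

/-! ### Dual digit sets -/

/-- `S` is a dual digit set of `A` modulo `n`: the exponentials with frequencies `s / n`, `s ∈ S`,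
form an orthogonal basis of the functions on `A`. The normalization `0 ∈ S` makes the sets of
integers with `k` digits in `S` increase with `k`. -/
structure IsDual (A : Finset ℕ) (n : ℕ) (S : Finset ℤ) : Prop where
  zero_mem : (0 : ℤ) ∈ S
  card_eq : S.card = A.card
  mask_eq_zero : ∀ s ∈ S, ∀ s' ∈ S, s ≠ s' → mask A (((s : ℝ) - s') / n) = 0

theorem isDual_singleton_zero (n : ℕ) : IsDual {0} n {0} := by
  refine ⟨by simp, by simp, ?_⟩
  simp only [Finset.mem_singleton]
  rintro s rfl s' rfl h
  exact absurd rfl h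

theorem IsDual.image_mul {A' A : Finset ℕ} {m n' : ℕ} {S : Finset ℤ} (h : IsDual A' n' S)
    (hm : 0 < m) (hA : A = A'.image (m * ·)) : IsDual A (m * n') S := by
  refine ⟨h.zero_mem, ?_, fun s hs s' hs' hne => ?_⟩
  · rw [hA, h.card_eq,
      Finset.card_image_of_injective _ (fun x y h => Nat.eq_of_mul_eq_mul_left hm h)]
  · rw [hA, mask_image_mul hm, ← h.mask_eq_zero s hs s' hs' hne]
    have : (m : ℝ) ≠ 0 := by exact_mod_cast hm.ne'
    congr 1
    push_cast
    rw [← mul_div_assoc, mul_div_mul_left _ _ this]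

/-- A dual digit set `S` of `A'` modulo `n'` gives the dual digit set
`S ⊕ n' {0, …, m - 1}` of `{0, …, m - 1} ⊕ m A'` modulo `m n'`. -/
theorem IsDual.block {A' A : Finset ℕ} {m n' : ℕ} {S : Finset ℤ} (h : IsDual A' n' S)
    (hm : 0 < m) (hn' : 0 < n') (hA'0 : A'.Nonempty) (hA : ∀ x, x ∈ A ↔ x / m ∈ A') :
    ∃ S', IsDual A (m * n') S' := by
  have hm0 : (m : ℝ) ≠ 0 := by exact_mod_cast hm.ne'
  have hn0 : (n' : ℝ) ≠ 0 := by exact_mod_cast hn'.ne'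
  have hS : ∀ s ∈ S, ∀ s' ∈ S, ∀ i j : ℤ, s ≠ s' →
      mask A' (m * (((s + n' * i : ℤ) - (s' + n' * j : ℤ) : ℝ) / (m * n' : ℕ))) = 0 := by
    intro s hs s' hs' i j hne
    rw [← h.mask_eq_zero s hs s' hs' hne, ← mask_add_intCast A' ((s - s') / n') (i - j)]
    congr 1
    push_cast
    field_simp
    ring
  have hinj : Set.InjOn (fun x : ℤ × ℕ => x.1 + n' * (x.2 : ℤ))
      (S ×ˢ Finset.range m : Finset (ℤ × ℕ)) := by
    rintro ⟨s, i⟩ hx ⟨s', j⟩ hy hxy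
    simp only [Finset.coe_product, Set.mem_prod, Finset.mem_coe, Finset.mem_range] at hx hy hxy
    have h1 : s = s' := by
      by_contra hne
      have := hS s hx.1 s' hy.1 i j hne
      rw [hxy, sub_self, zero_div, mul_zero] at this
      have h2 := mask_intCast hA'0 0
      rw [Int.cast_zero, this] at h2
      exact zero_ne_one h2
    subst h1
    simpa [hn'.ne'] using hxy
  refine ⟨(S ×ˢ Finset.range m).image (fun x : ℤ × ℕ => x.1 + n' * (x.2 : ℤ)), ?_, ?_, ?_⟩
  · exact Finset.mem_image.2 ⟨(0, 0), by simp [h.zero_mem, hm], by simp⟩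
  · rw [Finset.card_image_of_injOn hinj, Finset.card_product, Finset.card_range, h.card_eq,
      (mask_block hm hA 0).1, mul_comm]
  · simp only [Finset.forall_mem_image, Finset.mem_product, Prod.forall, Finset.mem_range]
    intro s i hs s' j hs' hne
    rw [(mask_block hm hA _).2]
    by_cases hss : s = s'
    · subst hss
      refine mul_eq_zero_of_left ?_ _
      have hij : i ≠ j := by rintro rfl; exact hne rfl
      have : ¬ (m : ℤ) ∣ (i : ℤ) - j := by
        intro hd
        have := Int.eq_zero_of_abs_lt_dvd hd (by rw [abs_lt]; omega)
        omega
      rw [← mask_range_eq_zero hm this]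
      congr 1
      push_cast
      field_simp
      ring
    · exact mul_eq_zero_of_right _ (hS s hs.1 s' hs'.1 i j hss)

theorem IsDirectSumRange.exists_isDual {n : ℕ} : ∀ {A B : Finset ℕ}, 0 < n →
    IsDirectSumRange A B n → ∃ S, IsDual A n S := by
  induction n using Nat.strong_induction_on with
  | _ n ih =>
  intro A B hn h
  obtain ⟨h0A, h0B⟩ := h.zero_mem hn
  by_cases hA : A = {0}
  · exact ⟨{0}, hA ▸ isDual_singleton_zero n⟩
  have hmin : ∀ D : Finset ℕ, 0 ∈ D → D ≠ {0} → 1 ∉ D →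
      ∃ m ∈ D, 1 < m ∧ ∀ b ∈ D, b ≠ 0 → m ≤ b := by
    intro D hD0 hD hD1
    have hne : (D.erase 0).Nonempty := by
      rw [Finset.nonempty_iff_ne_empty]
      intro he
      rw [Finset.erase_eq_empty_iff] at he
      rcases he with rfl | he
      · simp at hD0
      · exact hD he
    have hmem := Finset.min'_mem _ hne
    rw [Finset.mem_erase] at hmem
    refine ⟨_, hmem.2, ?_, fun b hb hb0 => Finset.min'_le _ _ (Finset.mem_erase.2 ⟨hb0, hb⟩)⟩
    have : (D.erase 0).min' hne ≠ 1 := fun e => hD1 (e ▸ hmem.2)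
    have := hmem.1
    omega
  have hn1 : 1 < n := by
    by_contra hc
    obtain rfl : n = 1 := by omega
    apply hA
    ext x
    rw [Finset.mem_singleton]
    exact ⟨fun hx => by have := (isDirectSumRange_iff.1 h).2.1 x hx 0 h0B; omega, fun e => e ▸ h0A⟩
  have hlt : ∀ {m n' : ℕ}, 1 < m → n = m * n' → 0 < n' ∧ n' < n := by
    intro m n' hm hmn
    have : 0 < n' := Nat.pos_of_ne_zero (by rintro rfl; omega)
    exact ⟨this, by rw [hmn]; nlinarith⟩
  by_cases hB : B = {0}
  · have : ∀ x, x ∈ A ↔ x / n ∈ ({0} : Finset ℕ) := by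
      intro x
      rw [Finset.mem_singleton, Nat.div_eq_zero_iff, or_iff_right hn.ne', ← Finset.mem_range, ← h.2,
        hB]
      simp
    simpa using (isDual_singleton_zero 1).block hn one_pos (by simp) this
  by_cases h1 : 1 ∈ A
  · have h1B : 1 ∉ B := fun h1B => by
      have := (isDirectSumRange_iff.1 h).1 1 h1 0 h0B 0 h0A 1 h1B rfl
      omega
    obtain ⟨m, hmB, hm, hmin⟩ := hmin B h0B hB h1B
    obtain ⟨A', B', n', rfl, h', hA', -⟩ := h.exists_block hn hm hmB hmin
    obtain ⟨hn', hn'lt⟩ := hlt hm rfl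
    obtain ⟨S, hS⟩ := ih n' hn'lt hn' h'
    exact hS.block (by omega) hn' ⟨0, (h'.zero_mem hn').1⟩ hA'
  · obtain ⟨m, hmA, hm, hmin⟩ := hmin A h0A hA h1
    obtain ⟨B', A', n', rfl, h', -, hA'⟩ := h.symm.exists_block hn hm hmA hmin
    obtain ⟨hn', hn'lt⟩ := hlt hm rfl
    obtain ⟨S, hS⟩ := ih n' hn'lt hn' h'.symm
    refine ⟨S, hS.image_mul (by omega) ?_⟩
    ext x
    rw [hA', Finset.mem_image]
    constructor
    · rintro ⟨⟨k, rfl⟩, hk⟩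
      rw [Nat.mul_div_cancel_left _ (by omega)] at hk
      exact ⟨k, hk, rfl⟩
    · rintro ⟨k, hk, rfl⟩
      exact ⟨⟨k, rfl⟩, by rwa [Nat.mul_div_cancel_left _ (by omega)]⟩

/-- A dual digit set can be moved modulo `n` into the interval `[-n / 2, n / 2]`. -/
theorem IsDual.exists_balanced {A : Finset ℕ} {n : ℕ} {S : Finset ℤ} (h : IsDual A n S)
    (hn : 0 < n) (hA : A.Nonempty) :
    ∃ S', IsDual A n S' ∧ ∀ s ∈ S', |(s : ℝ)| ≤ n / 2 := by
  have hn0 : (n : ℝ) ≠ 0 := by exact_mod_cast hn.ne'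
  have hmod : ∀ s s' : ℤ, mask A (((s.bmod n : ℤ) - (s'.bmod n : ℤ) : ℝ) / n) =
      mask A (((s : ℝ) - s') / n) := by
    intro s s'
    have e1 : ∀ s : ℤ, ((s.bmod n : ℤ) : ℝ) = s - n * (s.bdiv n : ℤ) := fun s => by
      have := Int.bmod_add_bdiv s n
      rw [eq_sub_iff_add_eq]
      exact_mod_cast this
    rw [← mask_add_intCast A _ (s.bdiv n - s'.bdiv n), e1, e1]
    congr 1
    push_cast
    field_simp
    ring
  have hinj : Set.InjOn (fun s : ℤ => s.bmod n) S := by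
    intro s hs s' hs' hss
    by_contra hne
    have h0 := h.mask_eq_zero s hs s' hs' hne
    simp only at hss
    rw [← hmod, hss, sub_self, zero_div] at h0
    have h2 := mask_intCast hA 0
    rw [Int.cast_zero, h0] at h2
    exact zero_ne_one h2
  refine ⟨S.image (fun s => s.bmod n), ⟨?_, ?_, ?_⟩, ?_⟩
  · exact Finset.mem_image.2 ⟨0, h.zero_mem, by simp⟩
  · rw [Finset.card_image_of_injOn hinj, h.card_eq]
  · simp only [Finset.forall_mem_image]
    intro s hs s' hs' hne
    rw [hmod]
    exact h.mask_eq_zero s hs s' hs' (by rintro rfl; exact hne rfl)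
  · simp only [Finset.forall_mem_image]
    intro s hs
    have h1 := Int.le_bmod (x := s) hn
    have h2 := Int.bmod_lt (x := s) hn
    have h3 : 2 * |s.bmod n| ≤ n := by
      rcases abs_cases (s.bmod n) with h | h <;> omega
    have h4 : (2 * |((s.bmod n : ℤ) : ℝ)| : ℝ) ≤ n := by exact_mod_cast h3
    linarith

/-- Parseval's identity for the orthogonal basis given by a dual digit set. -/
theorem IsDual.sum_sq_norm_mask {A : Finset ℕ} {n : ℕ} {S : Finset ℤ} (h : IsDual A n S)
    (hA : A.Nonempty) (t : ℝ) : ∑ s ∈ S, ‖mask A (t + s / n)‖ ^ 2 = 1 := by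
  have hA0 : (A.card : ℂ) ≠ 0 := by exact_mod_cast hA.card_ne_zero
  let U : Matrix S A ℂ := fun s a => expFun ((s : ℤ) / n) (a : ℕ)
  let V : Matrix A S ℂ := fun a s => (A.card : ℂ)⁻¹ * expFun (-((s : ℤ) / n : ℝ)) (a : ℕ)
  have hUV : U * V = 1 := by
    ext s s'
    have e : (U * V) s s' = mask A ((((s : ℤ) : ℝ) - (s' : ℤ)) / n) := by
      rw [Matrix.mul_apply, mask, Finset.mul_sum, ← Finset.sum_coe_sort A]
      refine Finset.sum_congr rfl fun a _ => ?_
      simp only [U, V]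
      rw [sub_div, sub_eq_add_neg, expFun_add]
      ring
    rw [e]
    by_cases hs : s = s'
    · subst hs
      have := mask_intCast hA 0
      rw [Int.cast_zero] at this
      simp [this]
    · rw [Matrix.one_apply_ne hs]
      exact h.mask_eq_zero _ s.2 _ s'.2 (fun e => hs (Subtype.ext e))
  have hVU : V * U = 1 := (Matrix.mul_eq_one_comm_of_card_eq _ _ _ (by simpa using h.card_eq)).1 hUV
  have hconj : ∀ s : ℤ, (starRingEnd ℂ) (mask A (t + s / n)) =
      (A.card : ℂ)⁻¹ * ∑ b ∈ A, expFun (-t) b * expFun (-(s / n : ℝ)) b := by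
    intro s
    rw [mask, map_mul, map_sum, map_inv₀, Complex.conj_natCast]
    simp only [expFun_add, map_mul, conj_expFun]
  have key : (∑ s ∈ S, (mask A (t + s / n)) * (starRingEnd ℂ) (mask A (t + s / n))) = 1 := by
    calc _ = ∑ s : S, (A.card : ℂ)⁻¹ * ∑ a : A, ∑ b : A,
          (expFun t (a : ℕ) * expFun (-t) (b : ℕ)) * (V b s * U s a) := by
          rw [← Finset.sum_coe_sort]
          refine Finset.sum_congr rfl fun s _ => ?_
          rw [hconj, mask, mul_assoc, mul_left_comm (∑ a ∈ A, _), Finset.sum_mul_sum,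
            ← Finset.sum_coe_sort A]
          congr 1
          rw [Finset.mul_sum]
          refine Finset.sum_congr rfl fun a _ => ?_
          rw [← Finset.sum_coe_sort A, Finset.mul_sum]
          refine Finset.sum_congr rfl fun b _ => ?_
          simp only [U, V, expFun_add]
          ring
      _ = (A.card : ℂ)⁻¹ * ∑ a : A, ∑ b : A,
          (expFun t (a : ℕ) * expFun (-t) (b : ℕ)) * (V * U) b a := by
          rw [← Finset.mul_sum, Finset.sum_comm]
          congr 1
          refine Finset.sum_congr rfl fun a _ => ?_
          rw [Finset.sum_comm]
          refine Finset.sum_congr rfl fun b _ => ?_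
          rw [Matrix.mul_apply, Finset.mul_sum]
      _ = 1 := by
          rw [hVU]
          simp [Matrix.one_apply, ← expFun_add, expFun_zero, hA0]
  have e : ∀ z : ℂ, z * (starRingEnd ℂ) z = ((‖z‖ ^ 2 : ℝ) : ℂ) := fun z => by
    rw [Complex.mul_conj, Complex.normSq_eq_norm_sq]
  simp only [e] at key
  exact_mod_cast key

/-! ### The self-similar measure -/

/-- The Fourier transform `t ↦ ∫ e^{2π i t x} dν(x)` of a measure. -/
noncomputable def fourierMeasure (ν : Measure ℝ) (t : ℝ) : ℂ := ∫ x, expFun t x ∂ν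

theorem fourierMeasure_eq_charFun (ν : Measure ℝ) (t : ℝ) :
    fourierMeasure ν t = charFun ν (2 * Real.pi * t) := by
  rw [fourierMeasure, charFun_apply_real]
  congr 1
  ext x
  rw [expFun]
  congr 1
  push_cast
  ring

theorem fourierMeasure_zero (ν : Measure ℝ) [IsProbabilityMeasure ν] : fourierMeasure ν 0 = 1 := by
  simp [fourierMeasure, expFun_zero]

theorem norm_fourierMeasure_le_one (ν : Measure ℝ) [IsProbabilityMeasure ν] (t : ℝ) :
    ‖fourierMeasure ν t‖ ≤ 1 := by
  rw [fourierMeasure_eq_charFun]; exact norm_charFun_le_one _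

theorem continuous_fourierMeasure (ν : Measure ℝ) [IsFiniteMeasure ν] :
    Continuous (fourierMeasure ν) := by
  refine continuous_of_dominated (bound := fun _ => 1)
    (fun t => (continuous_expFun t).aestronglyMeasurable)
    (fun t => Filter.Eventually.of_forall fun x => (norm_expFun t x).le) (integrable_const _)
    (Filter.Eventually.of_forall fun x => by unfold expFun; fun_prop)

theorem measure_ext_of_fourierMeasure {μ ν : Measure ℝ} [IsFiniteMeasure μ] [IsFiniteMeasure ν]
    (h : ∀ t, fourierMeasure μ t = fourierMeasure ν t) : μ = ν := by
  refine Measure.ext_of_charFun (funext fun t => ?_)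
  have := h (t / (2 * Real.pi))
  rwa [fourierMeasure_eq_charFun, fourierMeasure_eq_charFun,
    mul_div_cancel₀ _ (by positivity)] at this

theorem integrable_expFun (ν : Measure ℝ) [IsFiniteMeasure ν] (t : ℝ) :
    Integrable (expFun t) ν :=
  Integrable.of_bound (continuous_expFun t).aestronglyMeasurable 1
    (Filter.Eventually.of_forall fun x => (norm_expFun t x).le)

theorem image_affine_eq_preimage {n : ℕ} (hn : 0 < n) (a : ℕ) (E : Set ℝ) :
    (fun x : ℝ => n * x - a) '' E = (fun x : ℝ => (x + a) / n) ⁻¹' E := by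
  have hn0 : (n : ℝ) ≠ 0 := by exact_mod_cast hn.ne'
  ext y
  constructor
  · rintro ⟨x, hx, rfl⟩
    simpa [hn0] using hx
  · intro hy
    exact ⟨_, hy, by field_simp; ring⟩

theorem IsSelfSimilar.eq_sum_map {A : Finset ℕ} {n : ℕ} {ν : Measure ℝ} (hn : 0 < n)
    (h : IsSelfSimilar A n ν) :
    ν = (A.card : ENNReal)⁻¹ • ∑ a ∈ A, ν.map (fun x : ℝ => (x + a) / n) := by
  ext E hE
  rw [h E hE, Measure.smul_apply, Measure.finsetSum_apply, smul_eq_mul]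
  congr 1
  refine Finset.sum_congr rfl fun a _ => ?_
  rw [image_affine_eq_preimage hn, Measure.map_apply (by fun_prop) hE]

theorem IsSelfSimilar.fourierMeasure_eq {A : Finset ℕ} {n : ℕ} {ν : Measure ℝ} (hn : 0 < n)
    [IsProbabilityMeasure ν] (h : IsSelfSimilar A n ν) (t : ℝ) :
    fourierMeasure ν t = mask A (t / n) * fourierMeasure ν (t / n) := by
  have hn0 : (n : ℝ) ≠ 0 := by exact_mod_cast hn.ne'
  have hp : ∀ a ∈ A, IsProbabilityMeasure (ν.map (fun x : ℝ => (x + a) / n)) := fun a _ =>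
    Measure.isProbabilityMeasure_map (by fun_prop)
  conv_lhs => rw [h.eq_sum_map hn, fourierMeasure, integral_smul_measure,
    integral_finsetSum_measure (fun a ha => by have := hp a ha; exact integrable_expFun _ _)]
  rw [mask, mul_assoc, Finset.sum_mul, ENNReal.toReal_inv, ENNReal.toReal_natCast]
  rw [Complex.real_smul]
  push_cast
  congr 1
  refine Finset.sum_congr rfl fun a _ => ?_
  rw [integral_map (by fun_prop) (continuous_expFun t).aestronglyMeasurable, fourierMeasure,
    ← integral_const_mul]
  congr 1
  ext x
  rw [← expFun_add_right, add_comm (a : ℝ), div_eq_inv_mul, ← expFun_mul_comm, div_eq_inv_mul]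

theorem tendsto_div_pow_atTop_zero {n : ℕ} (hn : 1 < n) (t : ℝ) :
    Filter.Tendsto (fun k : ℕ => t / (n : ℝ) ^ k) Filter.atTop (nhds 0) :=
  Filter.Tendsto.const_div_atTop
    (tendsto_pow_atTop_atTop_of_one_lt (by exact_mod_cast hn)) t

/-- The Fourier transform `∏_{j = 1}^{k} m_A(t / n ^ j)` of the `k`-th discrete approximation of
the self-similar measure. -/
noncomputable def maskProd (A : Finset ℕ) (n : ℕ) : ℕ → ℝ → ℂ
  | 0, _ => 1
  | k + 1, t => mask A (t / n) * maskProd A n k (t / n)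

theorem IsSelfSimilar.fourierMeasure_eq_maskProd {A : Finset ℕ} {n : ℕ} {ν : Measure ℝ}
    (hn : 0 < n) [IsProbabilityMeasure ν] (h : IsSelfSimilar A n ν) (k : ℕ) (t : ℝ) :
    fourierMeasure ν t = maskProd A n k t * fourierMeasure ν (t / n ^ k) := by
  induction k generalizing t with
  | zero => simp [maskProd]
  | succ k ih =>
    rw [h.fourierMeasure_eq hn, ih (t / n), maskProd, div_div, ← pow_succ', mul_assoc]

theorem tendsto_fourierMeasure_div_pow {n : ℕ} (ν : Measure ℝ) [IsProbabilityMeasure ν]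
    (hn : 1 < n) (t : ℝ) :
    Filter.Tendsto (fun k : ℕ => fourierMeasure ν (t / n ^ k)) Filter.atTop (nhds 1) := by
  have := (continuous_fourierMeasure ν).tendsto 0
  rw [fourierMeasure_zero] at this
  exact this.comp (tendsto_div_pow_atTop_zero hn t)

theorem IsSelfSimilar.tendsto_maskProd {A : Finset ℕ} {n : ℕ} {ν : Measure ℝ}
    (hn : 1 < n) [IsProbabilityMeasure ν] (h : IsSelfSimilar A n ν) (t : ℝ) :
    Filter.Tendsto (fun k : ℕ => maskProd A n k t) Filter.atTop (nhds (fourierMeasure ν t)) := by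
  have h1 := tendsto_fourierMeasure_div_pow ν hn t
  have h2 := (tendsto_const_nhds (x := fourierMeasure ν t)).div h1 one_ne_zero
  rw [div_one] at h2
  refine h2.congr' ?_
  filter_upwards [h1.eventually_ne one_ne_zero] with k hk
  simp only [Pi.div_apply]
  rw [h.fourierMeasure_eq_maskProd (by omega) k t, mul_div_cancel_right₀ _ hk]

theorem IsSelfSimilar.unique {A : Finset ℕ} {n : ℕ} {ν ν' : Measure ℝ}
    (hn : 1 < n) [IsProbabilityMeasure ν] [IsProbabilityMeasure ν'] (h : IsSelfSimilar A n ν)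
    (h' : IsSelfSimilar A n ν') : ν = ν' :=
  measure_ext_of_fourierMeasure fun t =>
    tendsto_nhds_unique (h.tendsto_maskProd hn t) (h'.tendsto_maskProd hn t)

/-- Prepending a term to a sequence. -/
def seqCons {α : Type*} (p : α × (ℕ → α)) : ℕ → α
  | 0 => p.1
  | k + 1 => p.2 k

theorem measurable_seqCons {α : Type*} [MeasurableSpace α] :
    Measurable (seqCons : α × (ℕ → α) → ℕ → α) := by
  rw [measurable_pi_iff]
  rintro (_ | k)
  · exact measurable_fst
  · exact (measurable_pi_apply k).comp measurable_snd

/-- Prepending an independent term to an i.i.d. sequence gives an i.i.d. sequence. -/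
theorem map_seqCons_prod {α : Type*} [MeasurableSpace α] (μ : Measure α) [IsProbabilityMeasure μ] :
    (μ.prod (Measure.infinitePi fun _ : ℕ => μ)).map seqCons =
      Measure.infinitePi fun _ : ℕ => μ := by
  refine Measure.eq_infinitePi _ fun s t ht => ?_
  -- it suffices to consider boxes whose index set is an initial segment
  have key : ∀ (N : ℕ) (t : ℕ → Set α), (∀ i, MeasurableSet (t i)) →
      ((μ.prod (Measure.infinitePi fun _ : ℕ => μ)).map seqCons)
        (Set.pi (Finset.range (N + 1)) t) = ∏ i ∈ Finset.range (N + 1), μ (t i) := by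
    intro N t ht
    rw [Measure.map_apply measurable_seqCons
      (MeasurableSet.pi (Finset.countable_toSet _) fun i _ => ht i)]
    have : seqCons ⁻¹' (Set.pi (Finset.range (N + 1)) t) =
        t 0 ×ˢ Set.pi (Finset.range N) (fun k => t (k + 1)) := by
      ext ⟨x, y⟩
      simp only [Set.mem_preimage, Set.mem_pi, Finset.mem_coe, Finset.mem_range, Set.mem_prod]
      constructor
      · exact fun h => ⟨h 0 (by omega), fun k hk => h (k + 1) (by omega)⟩
      · rintro ⟨h0, h⟩ (_ | k) hk
        · exact h0
        · exact h k (by omega)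
    rw [this, Measure.prod_prod, Measure.infinitePi_pi _ (fun i _ => ht (i + 1)),
      Finset.prod_range_succ', mul_comm]
  classical
  have h := key (s.sup id) (fun i => if i ∈ s then t i else Set.univ)
    (fun i => by split_ifs; exacts [ht i, MeasurableSet.univ])
  have hs : s ⊆ Finset.range (s.sup id + 1) := fun i hi =>
    Finset.mem_range.2 (Nat.lt_succ_of_le (Finset.le_sup (f := id) hi))
  have e1 : Set.pi (Finset.range (s.sup id + 1)) (fun i => if i ∈ s then t i else Set.univ) =
      Set.pi s t := by
    ext x
    simp only [Set.mem_pi, Finset.mem_coe]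
    constructor
    · intro h i hi
      simpa [hi] using h i (hs hi)
    · intro h i _
      split_ifs with hi
      · exact h i hi
      · trivial
  rw [e1] at h
  rw [h, ← Finset.prod_subset hs]
  · exact Finset.prod_congr rfl fun i hi => by simp [hi]
  · intro i _ hi
    simp [hi]

/-- The number with digits `ω 0, ω 1, …` after the point in base `n`. -/
noncomputable def digitSum {A : Finset ℕ} (n : ℕ) (ω : ℕ → A) : ℝ :=
  ∑' k, ((ω k : ℕ) : ℝ) / n ^ (k + 1)

theorem hasSum_digits_top {n : ℕ} (hn : 1 < n) :
    HasSum (fun k : ℕ => ((n : ℝ) - 1) / n ^ (k + 1)) 1 := by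
  have hn1 : (1 : ℝ) < n := by exact_mod_cast hn
  have h := hasSum_geometric_of_lt_one (r := (n : ℝ)⁻¹) (by positivity)
    (inv_lt_one_of_one_lt₀ hn1)
  have h2 := h.mul_left (((n : ℝ) - 1) / n)
  have e1 : (fun k : ℕ => ((n : ℝ) - 1) / n ^ (k + 1)) =
      fun k => ((n : ℝ) - 1) / n * (n : ℝ)⁻¹ ^ k := by
    ext k
    rw [inv_pow, pow_succ]
    field_simp
  have e2 : ((n : ℝ) - 1) / n * (1 - (n : ℝ)⁻¹)⁻¹ = 1 := by
    have : (n : ℝ) - 1 ≠ 0 := by linarith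
    field_simp
  rw [e2] at h2
  rwa [e1]

theorem digit_le {A : Finset ℕ} {n : ℕ} (hA : ∀ a ∈ A, a < n) (ω : ℕ → A) (k : ℕ) :
    ((ω k : ℕ) : ℝ) / n ^ (k + 1) ≤ ((n : ℝ) - 1) / n ^ (k + 1) := by
  have h : ((ω k : ℕ) : ℝ) + 1 ≤ n := by exact_mod_cast hA _ (ω k).2
  gcongr
  linarith

theorem summable_digits {A : Finset ℕ} {n : ℕ} (hn : 1 < n) (hA : ∀ a ∈ A, a < n) (ω : ℕ → A) :
    Summable fun k => ((ω k : ℕ) : ℝ) / n ^ (k + 1) :=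
  Summable.of_nonneg_of_le (fun _ => by positivity) (digit_le hA ω) (hasSum_digits_top hn).summable

theorem digitSum_mem_Icc {A : Finset ℕ} {n : ℕ} (hn : 1 < n) (hA : ∀ a ∈ A, a < n) (ω : ℕ → A) :
    digitSum n ω ∈ Set.Icc (0 : ℝ) 1 :=
  ⟨tsum_nonneg fun _ => by positivity,
    hasSum_le (digit_le hA ω) (summable_digits hn hA ω).hasSum (hasSum_digits_top hn)⟩

theorem digitSum_seqCons {A : Finset ℕ} {n : ℕ} (hn : 1 < n) (hA : ∀ a ∈ A, a < n)
    (p : A × (ℕ → A)) : digitSum n (seqCons p) = (digitSum n p.2 + (p.1 : ℕ)) / n := by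
  rw [digitSum, (summable_digits hn hA _).tsum_eq_zero_add, digitSum, add_div, add_comm,
    ← tsum_div_const]
  simp [seqCons, pow_succ, div_div]

theorem measurable_digitSum {A : Finset ℕ} (n : ℕ) :
    Measurable (digitSum n : (ℕ → A) → ℝ) := by
  unfold digitSum
  refine Measurable.tsum fun k => ?_
  have : Measurable fun a : A => ((a : ℕ) : ℝ) := measurable_of_countable _
  exact (this.comp (measurable_pi_apply k)).div_const _

/-- The distribution of a number whose digits in base `n` are independent and uniformly distributed
on `A` is self-similar. -/
theorem exists_isSelfSimilar {A : Finset ℕ} {n : ℕ} (hn : 1 < n) (hA : ∀ a ∈ A, a < n)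
    (hA0 : A.Nonempty) : ∃ ν : ProbabilityMeasure ℝ, IsSelfSimilar A n (ν : Measure ℝ) ∧
      (ν : Measure ℝ) (Set.Icc 0 1)ᶜ = 0 := by
  have hc : (A.card : ENNReal) ≠ 0 := by exact_mod_cast hA0.card_ne_zero
  let μ : Measure A := (A.card : ENNReal)⁻¹ • Measure.count
  have hμ : IsProbabilityMeasure μ := ⟨by
    simp [μ, Measure.count_univ, ENNReal.inv_mul_cancel hc]⟩
  let P : Measure (ℕ → A) := Measure.infinitePi fun _ : ℕ => μ
  have hX := measurable_digitSum (A := A) n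
  refine ⟨⟨P.map (digitSum n), Measure.isProbabilityMeasure_map hX.aemeasurable⟩, ?_, ?_⟩
  · intro E hE
    change (P.map (digitSum n)) E = _ * ∑ a ∈ A, (P.map (digitSum n)) _
    have hE' : MeasurableSet (digitSum n ⁻¹' E : Set (ℕ → A)) := hX hE
    have hPP : P.map (digitSum n) E = (μ.prod P) (seqCons ⁻¹' (digitSum n ⁻¹' E)) := by
      rw [Measure.map_apply hX hE, ← Measure.map_apply measurable_seqCons hE', map_seqCons_prod]
    rw [hPP, Measure.prod_apply (measurable_seqCons hE'), lintegral_smul_measure,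
      lintegral_count, tsum_fintype, smul_eq_mul, ← Finset.sum_coe_sort A]
    congr 1
    refine Finset.sum_congr rfl fun a _ => ?_
    rw [image_affine_eq_preimage (by omega),
      Measure.map_apply hX (by exact (by fun_prop : Measurable fun x : ℝ => (x + (a : ℕ)) / n) hE)]
    congr 1
    ext y
    simp only [Set.mem_preimage, digitSum_seqCons hn hA]
  · change (P.map (digitSum n)) _ = 0
    rw [Measure.map_apply hX measurableSet_Icc.compl]
    convert measure_empty (μ := P)
    ext ω
    simpa using digitSum_mem_Icc hn hA ω

theorem IsSelfSimilar.measure_compl_Icc {A : Finset ℕ} {n : ℕ} {ν : Measure ℝ} (hn : 1 < n)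
    (hA : ∀ a ∈ A, a < n) (hA0 : A.Nonempty) [IsProbabilityMeasure ν] (h : IsSelfSimilar A n ν) :
    ν (Set.Icc 0 1)ᶜ = 0 := by
  obtain ⟨ν', h', h1⟩ := exists_isSelfSimilar hn hA hA0
  rwa [h.unique hn h']

theorem IsSelfSimilar.measureReal_singleton {A : Finset ℕ} {n : ℕ} {ν : Measure ℝ}
    [IsProbabilityMeasure ν] (h : IsSelfSimilar A n ν) (x : ℝ) :
    ν.real {x} = (A.card : ℝ)⁻¹ * ∑ a ∈ A, ν.real {n * x - a} := by
  rw [measureReal_def, h _ (measurableSet_singleton x), ENNReal.toReal_mul, ENNReal.toReal_inv,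
    ENNReal.toReal_natCast, ENNReal.toReal_sum (fun a _ => measure_ne_top _ _)]
  simp [measureReal_def]

/-- First `0` and `1` are not atoms, as the relation for `ν {0}` and `ν {1}` has at most one
nonzero term, `ν {0}` and `ν {1}` again. For any other point, too, at most one digit contributes,
and iteration gives `ν {x} ≤ (#A)⁻¹ ^ k`. -/
theorem IsSelfSimilar.noAtoms {A : Finset ℕ} {n : ℕ} {ν : Measure ℝ} (hn : 1 < n)
    (hA : ∀ a ∈ A, a < n) (hA2 : 1 < A.card) [IsProbabilityMeasure ν] (h : IsSelfSimilar A n ν)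
    (x : ℝ) : ν {x} = 0 := by
  have hA0 : A.Nonempty := Finset.card_pos.1 (by omega)
  have hout : ∀ y : ℝ, y ∉ Set.Icc (0 : ℝ) 1 → ν.real {y} = 0 := fun y hy => by
    rw [measureReal_def, measure_mono_null (Set.singleton_subset_iff.2 hy)
      (h.measure_compl_Icc hn hA hA0), ENNReal.toReal_zero]
  have hc1 : (1 : ℝ) < A.card := by exact_mod_cast hA2
  have hcinv : (A.card : ℝ)⁻¹ < 1 := inv_lt_one_of_one_lt₀ hc1
  -- a point that only the digit `a₀` maps into `[0, 1]`, namely to itself, is not an atom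
  have hend : ∀ y : ℝ, ∀ a₀ : ℕ, (∀ a ∈ A, a ≠ a₀ → ν.real {n * y - a} = 0) →
      n * y - a₀ = y → ν.real {y} = 0 := by
    intro y a₀ h1 h2
    have h3 := h.measureReal_singleton y
    have h4 : ∑ a ∈ A, ν.real {n * y - a} ≤ ν.real {y} := by
      calc _ ≤ ∑ a ∈ A, if a = a₀ then ν.real {y} else 0 := by
            refine Finset.sum_le_sum fun a ha => ?_
            split_ifs with e
            · rw [e, h2]
            · rw [h1 a ha e]
        _ ≤ ν.real {y} := by
            rw [Finset.sum_ite_eq' A a₀]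
            split_ifs
            · exact le_rfl
            · exact measureReal_nonneg
    have h5 : 0 ≤ ν.real {y} := measureReal_nonneg
    have h6 : ν.real {y} ≤ (A.card : ℝ)⁻¹ * ν.real {y} := by
      conv_lhs => rw [h3]
      gcongr
    nlinarith
  have h0 : ν.real {0} = 0 := by
    refine hend 0 0 (fun a ha hne => hout _ fun hmem => ?_) (by simp)
    have : (0 : ℝ) < a := by exact_mod_cast Nat.pos_of_ne_zero hne
    linarith [hmem.1]
  have h1 : ν.real {1} = 0 := by
    refine hend 1 (n - 1) (fun a ha hne => hout _ fun hmem => ?_) ?_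
    · have : a + 2 ≤ n := by have := hA a ha; omega
      have : (a : ℝ) + 2 ≤ n := by exact_mod_cast this
      linarith [hmem.2]
    · rw [Nat.cast_sub (by omega)]; simp
  have hbound : ∀ k : ℕ, ∀ y : ℝ, ν.real {y} ≤ (A.card : ℝ)⁻¹ ^ k := by
    intro k
    induction k with
    | zero => exact fun y => by simp
    | succ k ih =>
      intro y
      rw [h.measureReal_singleton, pow_succ']
      gcongr
      -- only the integer part of `n * y` contributes, as `0` and `1` are not atoms
      calc _ ≤ ∑ a ∈ A, if a = ⌊n * y⌋₊ then (A.card : ℝ)⁻¹ ^ k else 0 := by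
            refine Finset.sum_le_sum fun a ha => ?_
            split_ifs with e
            · exact ih _
            · by_cases hmem : n * y - a ∈ Set.Icc (0 : ℝ) 1
              · rcases eq_or_lt_of_le hmem.1 with e0 | e0
                · rw [← e0, h0]
                · rcases eq_or_lt_of_le hmem.2 with e1 | e1
                  · rw [e1, h1]
                  · exact absurd ((Nat.floor_eq_iff (by linarith [Nat.cast_nonneg (α := ℝ) a])).2
                      ⟨by linarith, by linarith⟩).symm e
              · exact (hout _ hmem).le
        _ ≤ _ := by
            rw [Finset.sum_ite_eq' A]
            split_ifs
            · exact le_rfl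
            · positivity
  have hlim := tendsto_pow_atTop_nhds_zero_of_lt_one (r := (A.card : ℝ)⁻¹) (by positivity) hcinv
  have h2 := ge_of_tendsto' hlim (fun k => hbound k x)
  have h3 : ν.real {x} = 0 := le_antisymm h2 measureReal_nonneg
  rwa [measureReal_eq_zero_iff] at h3

/-- The support `K` is contained in `⋃ a, (K + a) / n`, so its volume `v` satisfies
`v ≤ (#A / n) v`. -/
theorem IsSelfSimilar.mutuallySingular {A : Finset ℕ} {n : ℕ} {ν : Measure ℝ} (hn : 1 < n)
    (hA : ∀ a ∈ A, a < n) (hA0 : A.Nonempty) (hAn : A.card < n) [IsProbabilityMeasure ν]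
    (h : IsSelfSimilar A n ν) : ν.MutuallySingular volume := by
  have hn0 : (n : ℝ) ≠ 0 := by positivity
  set K := ν.support with hK
  have hKc : IsClosed K := Measure.isClosed_support
  have hKsub : K ⊆ Set.Icc 0 1 := Measure.support_subset_of_isClosed isClosed_Icc
    (mem_ae_iff.2 (h.measure_compl_Icc hn hA hA0))
  have hKcomp : IsCompact K := isCompact_Icc.of_isClosed_subset hKc hKsub
  set F : Set ℝ := ⋃ a ∈ A, (fun x : ℝ => (x + a) / n) '' K with hF
  have hFc : IsClosed F := by
    refine (A.isCompact_biUnion fun a _ => hKcomp.image ?_).isClosed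
    fun_prop
  have hνF : ν Fᶜ = 0 := by
    rw [h _ hFc.isOpen_compl.measurableSet, Finset.sum_eq_zero, mul_zero]
    intro a ha
    refine measure_mono_null ?_ Measure.measure_compl_support
    rw [image_affine_eq_preimage (by omega)]
    intro x hx hxK
    exact hx (Set.mem_biUnion ha ⟨x, hxK, rfl⟩)
  have hKF : K ⊆ F := Measure.support_subset_of_isClosed hFc (mem_ae_iff.2 hνF)
  have hpiece : ∀ a : ℕ, volume ((fun x : ℝ => (x + a) / n) '' K) =
      ENNReal.ofReal (n : ℝ)⁻¹ * volume K := by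
    intro a
    have : (fun x : ℝ => (x + a) / n) '' K =
        (fun y : ℝ => n * y) ⁻¹' ((fun y : ℝ => y + (-(a : ℝ))) ⁻¹' K) := by
      ext y
      constructor
      · rintro ⟨x, hx, rfl⟩
        simpa [mul_div_cancel₀ _ hn0] using hx
      · intro hy
        exact ⟨_, hy, by field_simp; ring⟩
    rw [this, Real.volume_preimage_mul_left hn0, measure_preimage_add_right,
      abs_of_nonneg (by positivity)]
  have hfin : volume K ≠ ⊤ := hKcomp.measure_lt_top.ne
  have hvol : volume K ≤ A.card * (ENNReal.ofReal (n : ℝ)⁻¹ * volume K) := by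
    calc volume K ≤ volume F := measure_mono hKF
      _ ≤ ∑ a ∈ A, volume ((fun x : ℝ => (x + a) / n) '' K) := measure_biUnion_finset_le _ _
      _ = _ := by simp [hpiece]
  have hreal : volume.real K ≤ A.card * ((n : ℝ)⁻¹ * volume.real K) := by
    have := ENNReal.toReal_mono (by finiteness) hvol
    simpa [measureReal_def, ENNReal.toReal_mul] using this
  have hvol0 : volume K = 0 := by
    rw [← measureReal_eq_zero_iff hfin]
    have h1 : (A.card : ℝ) * (n : ℝ)⁻¹ < 1 := by
      rw [← div_eq_mul_inv, div_lt_one (by positivity)]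
      exact_mod_cast hAn
    have h2 : 0 ≤ volume.real K := measureReal_nonneg
    nlinarith
  exact ⟨Kᶜ, hKc.measurableSet.compl, Measure.measure_compl_support, by rwa [compl_compl]⟩

/-! ### Completeness of exponentials -/

theorem inner_expL2 (μ : Measure ℝ) [IsFiniteMeasure μ] (s t : ℝ) :
    inner ℂ (expL2 μ s) (expL2 μ t) = fourierMeasure μ (t - s) := by
  rw [L2.inner_def, fourierMeasure]
  refine integral_congr_ae ?_
  filter_upwards [(expFun_memLp μ s).coeFn_toLp, (expFun_memLp μ t).coeFn_toLp] with x hs ht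
  rw [expL2, expL2, hs, ht, RCLike.inner_apply, conj_expFun, sub_eq_add_neg, expFun_add]

theorem inner_self_eq_ofReal_norm_sq {H : Type*} [NormedAddCommGroup H] [InnerProductSpace ℂ H]
    (x : H) : inner ℂ x x = ((‖x‖ ^ 2 : ℝ) : ℂ) := by
  rw [inner_self_eq_norm_sq_to_K, Complex.ofReal_pow]
  rfl

theorem norm_expL2 (μ : Measure ℝ) [IsProbabilityMeasure μ] (t : ℝ) : ‖expL2 μ t‖ = 1 := by
  have h := inner_self_eq_ofReal_norm_sq (expL2 μ t)
  rw [inner_expL2, sub_self, fourierMeasure_zero] at h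
  have h2 : ‖expL2 μ t‖ ^ 2 = 1 := by exact_mod_cast h.symm
  exact (pow_eq_one_iff_of_nonneg (norm_nonneg _) two_ne_zero).1 h2

/-- A real integrable function with vanishing Fourier transform is zero: its positive and negative
part define measures with the same Fourier transform. -/
theorem ae_eq_zero_of_integral_expFun_mul_eq_zero {ν : Measure ℝ} [IsFiniteMeasure ν] {g : ℝ → ℝ}
    (hg : Integrable g ν) (h : ∀ t, ∫ x, expFun t x * (g x : ℂ) ∂ν = 0) : g =ᵐ[ν] 0 := by
  have hint : ∀ {k : ℝ → ℝ}, Integrable k ν → ∀ t, Integrable (fun x => expFun t x * (k x : ℂ)) ν :=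
    fun hk t => hk.ofReal.bdd_mul (continuous_expFun t).aestronglyMeasurable
      (Filter.Eventually.of_forall fun x => (norm_expFun t x).le)
  have hfin : ∀ {k : ℝ → ℝ}, Integrable k ν →
      IsFiniteMeasure (ν.withDensity fun x => ENNReal.ofReal (k x)) := fun hk =>
    isFiniteMeasure_withDensity_ofReal hk.2
  have hF : ∀ {k : ℝ → ℝ}, Integrable k ν → ∀ t,
      fourierMeasure (ν.withDensity fun x => ENNReal.ofReal (k x)) t =
        ∫ x, expFun t x * ((max (k x) 0 : ℝ) : ℂ) ∂ν := by
    intro k hk t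
    rw [fourierMeasure, integral_withDensity_eq_integral_toReal_smul₀ hk.aemeasurable.ennreal_ofReal
      (Filter.Eventually.of_forall fun x => ENNReal.ofReal_lt_top)]
    congr 1
    ext x
    rw [ENNReal.toReal_ofReal', Complex.real_smul, mul_comm]
  have hp := hg.pos_part
  have hn := hg.neg_part
  have := hfin hg
  have := hfin hg.neg
  have heq : (ν.withDensity fun x => ENNReal.ofReal (g x)) =
      ν.withDensity fun x => ENNReal.ofReal ((-g) x) := by
    refine measure_ext_of_fourierMeasure fun t => ?_
    rw [hF hg, hF hg.neg, ← sub_eq_zero]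
    simp only [Pi.neg_apply]
    rw [← integral_sub (hint hp t) (hint hn t), ← h t]
    congr 1
    ext x
    rw [← mul_sub, ← Complex.ofReal_sub]
    congr 2
    rcases le_total (g x) 0 with h | h <;> simp [h]
  rw [withDensity_eq_iff hg.aemeasurable.ennreal_ofReal hg.neg.aemeasurable.ennreal_ofReal
    (hg.lintegral_lt_top).ne] at heq
  filter_upwards [heq] with x hx
  rcases lt_trichotomy (g x) 0 with h | h | h
  · rw [ENNReal.ofReal_of_nonpos h.le] at hx
    have := ENNReal.ofReal_eq_zero.1 hx.symm
    simp only [Pi.neg_apply] at this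
    linarith
  · exact h
  · rw [ENNReal.ofReal_of_nonpos (p := (-g) x) (by simp only [Pi.neg_apply]; linarith)] at hx
    have := ENNReal.ofReal_eq_zero.1 hx
    linarith

/-- The exponentials with arbitrary real frequencies are total in `L²(ν)`. This is the injectivity
of the Fourier transform, applied to the positive and negative parts of the real and imaginary
part. -/
theorem eq_zero_of_inner_expL2_eq_zero {ν : Measure ℝ} [IsFiniteMeasure ν] (f : Lp ℂ 2 ν)
    (h : ∀ t, inner ℂ (expL2 ν t) f = 0) : f = 0 := by
  have hf : Integrable f ν := (Lp.memLp f).integrable (by norm_num)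
  have h1 : ∀ t, ∫ x, expFun t x * f x ∂ν = 0 := by
    intro t
    rw [← h (-t), L2.inner_def]
    refine integral_congr_ae ?_
    filter_upwards [(expFun_memLp ν (-t)).coeFn_toLp] with x hx
    rw [expL2, hx, RCLike.inner_apply, conj_expFun, neg_neg, mul_comm]
  have hint : ∀ {k : ℝ → ℂ}, Integrable k ν → ∀ t, Integrable (fun x => expFun t x * k x) ν :=
    fun hk t => hk.bdd_mul (continuous_expFun t).aestronglyMeasurable
      (Filter.Eventually.of_forall fun x => (norm_expFun t x).le)
  have hre : ∀ {k : ℝ → ℂ}, Integrable k ν → (∀ t, ∫ x, expFun t x * k x ∂ν = 0) →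
      (fun x => (k x).re) =ᵐ[ν] 0 := by
    intro k hk h1
    refine ae_eq_zero_of_integral_expFun_mul_eq_zero hk.re fun t => ?_
    have hk' : Integrable (fun x => (starRingEnd ℂ) (k x)) ν :=
      hk.mono (Complex.continuous_conj.comp_aestronglyMeasurable hk.1) (by simp)
    have h2 : ∫ x, expFun t x * (starRingEnd ℂ) (k x) ∂ν = 0 := by
      rw [← map_zero (starRingEnd ℂ), ← h1 (-t), ← integral_conj]
      simp only [map_mul, conj_expFun, neg_neg]
    have h3 : (fun x => expFun t x * ((k x).re : ℂ)) = fun x =>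
        (1 / 2 : ℂ) * (expFun t x * k x + expFun t x * (starRingEnd ℂ) (k x)) := by
      ext x
      rw [← mul_add, Complex.add_conj]
      push_cast
      ring
    change ∫ x, expFun t x * ((k x).re : ℂ) ∂ν = 0
    rw [h3, integral_const_mul, integral_add (hint hk t) (hint hk' t), h1, h2]
    simp
  have him := hre (hf.const_mul Complex.I) (fun t => by
    simp only [mul_left_comm _ Complex.I]
    rw [integral_const_mul, h1, mul_zero])
  rw [Lp.eq_zero_iff_ae_eq_zero]
  filter_upwards [hre hf h1, him] with x hx hy
  refine Complex.ext hx ?_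
  simpa using hy

/-- If an orthonormal family satisfies Parseval's identity at `x`, then every vector orthogonal to
the family is orthogonal to `x`. -/
theorem Orthonormal.inner_eq_zero_of_hasSum {ι H : Type*} [NormedAddCommGroup H]
    [InnerProductSpace ℂ H] {v : ι → H} (hv : Orthonormal ℂ v) {x f : H}
    (hx : HasSum (fun i => ‖inner ℂ (v i) x‖ ^ 2) (‖x‖ ^ 2)) (hf : ∀ i, inner ℂ (v i) f = 0) :
    inner ℂ x f = 0 := by
  have key : ∀ s : Finset ι, ‖inner ℂ x f‖ ^ 2 ≤
      (‖x‖ ^ 2 - ∑ i ∈ s, ‖inner ℂ (v i) x‖ ^ 2) * ‖f‖ ^ 2 := by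
    intro s
    -- subtract from `x` its projection to the span of finitely many members of the family
    set p := ∑ i ∈ s, inner ℂ (v i) x • v i with hp
    have hpf : inner ℂ p f = 0 := by
      rw [hp, sum_inner]
      exact Finset.sum_eq_zero fun i _ => by rw [inner_smul_left, hf, mul_zero]
    have hpp : inner ℂ p p = ((∑ i ∈ s, ‖inner ℂ (v i) x‖ ^ 2 : ℝ) : ℂ) := by
      rw [hp, hv.inner_sum]
      push_cast
      refine Finset.sum_congr rfl fun i _ => ?_
      exact Complex.conj_mul' _
    have hpx : inner ℂ p x = ((∑ i ∈ s, ‖inner ℂ (v i) x‖ ^ 2 : ℝ) : ℂ) := by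
      rw [hp, sum_inner]
      push_cast
      refine Finset.sum_congr rfl fun i _ => ?_
      rw [inner_smul_left]
      exact Complex.conj_mul' _
    have hnorm : ‖x - p‖ ^ 2 = ‖x‖ ^ 2 - ∑ i ∈ s, ‖inner ℂ (v i) x‖ ^ 2 := by
      have hxp : inner ℂ x p = ((∑ i ∈ s, ‖inner ℂ (v i) x‖ ^ 2 : ℝ) : ℂ) := by
        rw [← inner_conj_symm, hpx, Complex.conj_ofReal]
      have h1 := inner_self_eq_ofReal_norm_sq (x - p)
      rw [inner_sub_left, inner_sub_right, inner_sub_right, hpp, hpx, hxp, sub_self, sub_zero,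
        inner_self_eq_ofReal_norm_sq] at h1
      exact_mod_cast h1.symm
    have h2 : inner ℂ x f = inner ℂ (x - p) f := by rw [inner_sub_left, hpf, sub_zero]
    rw [h2, ← hnorm, ← mul_pow]
    gcongr
    exact norm_inner_le_norm _ _
  have hlim := (tendsto_const_nhds (x := ‖x‖ ^ 2)).sub hx
  have hlim2 := hlim.mul_const (‖f‖ ^ 2)
  rw [sub_self, zero_mul] at hlim2
  have h0 : ‖inner ℂ x f‖ ^ 2 ≤ 0 := ge_of_tendsto' hlim2 key
  have h1 : ‖inner ℂ x f‖ = 0 := by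
    have := sq_nonneg ‖inner ℂ x f‖
    exact pow_eq_zero_iff two_ne_zero |>.1 (le_antisymm h0 this)
  exact norm_eq_zero.1 h1

/-! ### An integer spectrum of the self-similar measure -/

theorem maskProd_mul_maskProd {A B : Finset ℕ} {n : ℕ} (hn : 0 < n) (h : IsDirectSumRange A B n)
    (k : ℕ) (t : ℝ) : maskProd A n k t * maskProd B n k t *
      ((n : ℂ) ^ k * (expFun (t / n ^ k) 1 - 1)) = expFun t 1 - 1 := by
  have hn0 : (n : ℝ) ≠ 0 := by exact_mod_cast hn.ne'
  induction k generalizing t with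
  | zero => simp [maskProd]
  | succ k ih =>
    have h1 := ih (t / n)
    have h2 := mask_range_mul n (t / n)
    rw [mask_of_product A B _ h.1 h.2] at h2
    have h3 : expFun (t / n) n = expFun t 1 := by
      conv_rhs => rw [← mul_div_cancel₀ t hn0]
      rw [expFun_mul_comm, mul_one]
    rw [h3, ← h1] at h2
    rw [div_div, ← pow_succ'] at h2
    rw [maskProd, maskProd, ← h2]
    ring

theorem norm_maskProd_le_one (A : Finset ℕ) (n k : ℕ) (t : ℝ) : ‖maskProd A n k t‖ ≤ 1 := by
  induction k generalizing t with
  | zero => simp [maskProd]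
  | succ k ih =>
    rw [maskProd, norm_mul]
    exact mul_le_one₀ (norm_mask_le_one _ _) (norm_nonneg _) (ih _)

theorem norm_expFun_sub_one_le (t : ℝ) : ‖expFun t 1 - 1‖ ≤ 2 * Real.pi * |t| := by
  have h : (2 * Real.pi * Complex.I * t * (1 : ℝ) : ℂ) =
      Complex.I * ((2 * Real.pi * t : ℝ) : ℂ) := by
    push_cast; ring
  rw [expFun, h]
  refine (Real.norm_exp_I_mul_ofReal_sub_one_le).trans ?_
  rw [Real.norm_eq_abs, abs_mul, abs_of_nonneg (by positivity)]

/-- The masks of `A` and `B` multiply to a Dirichlet kernel, whose products telescope; as those of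
`B` are bounded by `1`, this bounds the ones of `A` from below. -/
theorem norm_expFun_sub_one_le_maskProd {A B : Finset ℕ} {n : ℕ} (hn : 0 < n)
    (h : IsDirectSumRange A B n) (k : ℕ) (t : ℝ) :
    ‖expFun t 1 - 1‖ ≤ ‖maskProd A n k t‖ * (2 * Real.pi * |t|) := by
  have hn0 : (0 : ℝ) < n := by exact_mod_cast hn
  rw [← maskProd_mul_maskProd hn h k t, norm_mul, norm_mul, mul_assoc]
  refine mul_le_mul_of_nonneg_left ?_ (norm_nonneg _)
  calc _ ≤ 1 * ‖(n : ℂ) ^ k * (expFun (t / n ^ k) 1 - 1)‖ := by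
        gcongr; exact norm_maskProd_le_one _ _ _ _
    _ = (n : ℝ) ^ k * ‖expFun (t / n ^ k) 1 - 1‖ := by simp
    _ ≤ (n : ℝ) ^ k * (2 * Real.pi * |t / n ^ k|) := by
        gcongr; exact norm_expFun_sub_one_le _
    _ = 2 * Real.pi * |t| := by
        rw [abs_div, abs_of_nonneg (pow_nonneg hn0.le k)]
        field_simp

/-- The Fourier transform of the self-similar measure has no zeros in `(-1, 1)`: the one of its
convolution with the measure belonging to the complementary digit set is that of Lebesgue measure
on `[0, 1]`. -/
theorem IsSelfSimilar.fourierMeasure_ne_zero {A B : Finset ℕ} {n : ℕ} {ν : Measure ℝ}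
    (hn : 1 < n) (hAB : IsDirectSumRange A B n) [IsProbabilityMeasure ν] (h : IsSelfSimilar A n ν)
    {t : ℝ} (ht : |t| < 1) : fourierMeasure ν t ≠ 0 := by
  intro h0
  have hlim := ((h.tendsto_maskProd hn t).norm).mul_const (2 * Real.pi * |t|)
  have h1 := ge_of_tendsto' hlim
    (fun k => norm_expFun_sub_one_le_maskProd (by omega) hAB k t)
  rw [h0, norm_zero, zero_mul] at h1
  have h2 : expFun t 1 = 1 := sub_eq_zero.1 (norm_eq_zero.1 (le_antisymm h1 (norm_nonneg _)))
  obtain ⟨k, rfl⟩ := (expFun_one_right_eq_one_iff t).1 h2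
  have hk : k = 0 := by
    have : |k| < 1 := by exact_mod_cast ht
    exact Int.abs_lt_one_iff.1 this
  rw [hk, Int.cast_zero, fourierMeasure_zero] at h0
  exact one_ne_zero h0

/-- The integers with at most `k` digits, all of them in `S`, in base `n`. -/
def digitSet (n : ℕ) (S : Finset ℤ) : ℕ → Finset ℤ
  | 0 => {0}
  | k + 1 => (S ×ˢ digitSet n S k).image fun x => x.1 + n * x.2

theorem IsDual.digitSet_subset_succ {A : Finset ℕ} {n : ℕ} {S : Finset ℤ} (h : IsDual A n S)
    (k : ℕ) : digitSet n S k ⊆ digitSet n S (k + 1) := by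
  induction k with
  | zero =>
    intro x hx
    rw [digitSet, Finset.mem_singleton] at hx
    exact Finset.mem_image.2 ⟨(0, 0), by simp [digitSet, h.zero_mem], by simp [hx]⟩
  | succ k ih =>
    rw [digitSet, digitSet]
    exact Finset.image_subset_image (Finset.product_subset_product_right ih)

theorem IsDual.digitSet_mono {A : Finset ℕ} {n : ℕ} {S : Finset ℤ} (h : IsDual A n S) :
    Monotone (digitSet n S) := monotone_nat_of_le_succ h.digitSet_subset_succ

/-- Expansions with digits in a dual digit set are unique, because its elements are distinct modulo
`n`. -/
theorem IsDual.injOn {A : Finset ℕ} {n : ℕ} {S : Finset ℤ} (h : IsDual A n S) (hn : 0 < n)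
    (hA : A.Nonempty) (T : Finset ℤ) :
    Set.InjOn (fun x : ℤ × ℤ => x.1 + n * x.2) (S ×ˢ T : Finset (ℤ × ℤ)) := by
  have hn0 : (n : ℝ) ≠ 0 := by exact_mod_cast hn.ne'
  rintro ⟨s, i⟩ hx ⟨s', j⟩ hy hxy
  simp only [Finset.coe_product, Set.mem_prod, Finset.mem_coe] at hx hy hxy
  have h1 : s = s' := by
    by_contra hne
    have h0 := h.mask_eq_zero s hx.1 s' hy.1 hne
    have e : ((s : ℝ) - s') / n = ((j - i : ℤ) : ℝ) := by
      have : (s : ℝ) + n * i = s' + n * j := by exact_mod_cast hxy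
      rw [div_eq_iff hn0]
      push_cast
      linarith
    rw [e, mask_intCast hA] at h0
    exact one_ne_zero h0
  subst h1
  simpa [hn.ne'] using hxy

/-- Orthogonality of the exponentials with frequencies in `digitSet n S k`: two of them differ in
some digit, and the lowest such digit produces a zero of the mask. -/
theorem IsDual.fourierMeasure_eq_zero {A : Finset ℕ} {n : ℕ} {S : Finset ℤ} {ν : Measure ℝ}
    (h : IsDual A n S) (hn : 0 < n) [IsProbabilityMeasure ν] (hν : IsSelfSimilar A n ν)
    (k : ℕ) : ∀ l ∈ digitSet n S k, ∀ l' ∈ digitSet n S k, l ≠ l' →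
      fourierMeasure ν ((l : ℝ) - l') = 0 := by
  have hn0 : (n : ℝ) ≠ 0 := by exact_mod_cast hn.ne'
  induction k with
  | zero =>
    simp only [digitSet, Finset.mem_singleton]
    rintro l rfl l' rfl hne
    exact absurd rfl hne
  | succ k ih =>
    simp only [digitSet, Finset.forall_mem_image, Finset.mem_product, Prod.forall]
    intro s l hs s' l' hs' hne
    have e : (((s + n * l : ℤ) : ℝ) - ((s' + n * l' : ℤ) : ℝ)) / n =
        ((s : ℝ) - s') / n + ((l - l' : ℤ) : ℝ) := by
      push_cast
      field_simp
      ring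
    rw [hν.fourierMeasure_eq hn, e, mask_add_intCast]
    by_cases hss : s = s'
    · subst hss
      have hll : l ≠ l' := by rintro rfl; exact hne rfl
      have := ih l hs.2 l' hs'.2 hll
      rw [sub_self, zero_div, zero_add, Int.cast_sub, this, mul_zero]
    · rw [h.mask_eq_zero s hs.1 s' hs'.1 hss, zero_mul]

/-- Parseval's identity for the `k`-th discrete approximation. -/
theorem IsDual.sum_sq_norm_maskProd {A : Finset ℕ} {n : ℕ} {S : Finset ℤ}
    (h : IsDual A n S) (hn : 0 < n) (hA : A.Nonempty) (k : ℕ) (t : ℝ) :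
    ∑ l ∈ digitSet n S k, ‖maskProd A n k (t + l)‖ ^ 2 = 1 := by
  have hn0 : (n : ℝ) ≠ 0 := by exact_mod_cast hn.ne'
  induction k generalizing t with
  | zero => simp [digitSet, maskProd]
  | succ k ih =>
    rw [digitSet, Finset.sum_image (h.injOn hn hA _), Finset.sum_product,
      ← h.sum_sq_norm_mask hA (t / n)]
    refine Finset.sum_congr rfl fun s _ => ?_
    rw [← mul_one (‖mask A _‖ ^ 2), ← ih (t / n + s / n), Finset.mul_sum]
    refine Finset.sum_congr rfl fun l _ => ?_
    have e : (t + ((s + n * l : ℤ) : ℝ)) / n = t / n + s / n + l := by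
      push_cast
      field_simp
      ring
    simp only
    rw [maskProd, e, mask_add_intCast, norm_mul, mul_pow]

theorem abs_le_of_mem_digitSet {n : ℕ} {S : Finset ℤ} (hn : 4 ≤ n)
    (hS : ∀ s ∈ S, |(s : ℝ)| ≤ n / 2) (k : ℕ) :
    ∀ l ∈ digitSet n S k, |(l : ℝ)| ≤ 2 / 3 * (n ^ k - 1) := by
  have hn4 : (4 : ℝ) ≤ n := by exact_mod_cast hn
  induction k with
  | zero => simp [digitSet]
  | succ k ih =>
    simp only [digitSet, Finset.forall_mem_image, Finset.mem_product, Prod.forall]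
    intro s l hs
    have h1 := hS s hs.1
    have h2 := ih l hs.2
    push_cast
    calc |(s : ℝ) + n * l| ≤ |(s : ℝ)| + n * |(l : ℝ)| := by
          refine (abs_add_le _ _).trans ?_
          rw [abs_mul, abs_of_nonneg (Nat.cast_nonneg n : (0 : ℝ) ≤ n)]
      _ ≤ n / 2 + n * (2 / 3 * (n ^ k - 1)) := by gcongr
      _ ≤ 2 / 3 * (n ^ (k + 1) - 1) := by rw [pow_succ]; nlinarith

/-- The integers all of whose digits in base `n` lie in `S`. -/
def digitUnion (n : ℕ) (S : Finset ℤ) : Set ℤ := {l | ∃ k, l ∈ digitSet n S k}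

/-- Parseval's identity for the exponential with frequency `-t`. By self-similarity
`|ν̂(t + l)| = |P_k(t + l)| |ν̂((t + l) / n ^ k)|` with `P_k = maskProd A n k`, where the squares
`|P_k(t + l)| ^ 2` sum up to `1` over the `l` with `k` digits. As the digits are at
most `n / 2` in modulus, the points
`(t + l) / n ^ k` stay in a compact part of `(-1, 1)`, where `ν̂` is bounded from below; thus the
dominated convergence theorem applies. -/
theorem IsDual.hasSum_sq_norm_fourierMeasure {A B : Finset ℕ} {n : ℕ} {S : Finset ℤ}
    {ν : Measure ℝ} (h : IsDual A n S) (hn : 4 ≤ n) (hAB : IsDirectSumRange A B n)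
    (hS : ∀ s ∈ S, |(s : ℝ)| ≤ n / 2)
    [IsProbabilityMeasure ν] (hν : IsSelfSimilar A n ν) (t : ℝ) :
    HasSum (fun l : digitUnion n S => ‖fourierMeasure ν (t + (l : ℤ))‖ ^ 2) 1 := by
  have hn0 : (0 : ℝ) < n := by positivity
  have hA : A.Nonempty := ⟨0, (hAB.zero_mem (by omega)).1⟩
  -- `5 / 6` exceeds the bound `2 / 3` for `|l| / n ^ k`, which leaves room for `|t| / n ^ k`
  obtain ⟨c, hc, hcle⟩ : ∃ c > 0, ∀ u ∈ Set.Icc (-(5 / 6) : ℝ) (5 / 6),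
      c ≤ ‖fourierMeasure ν u‖ := by
    obtain ⟨u, hu, hmin⟩ := (isCompact_Icc (a := (-(5 / 6) : ℝ)) (b := 5 / 6)).exists_isMinOn
      ⟨0, by norm_num⟩ (continuous_fourierMeasure ν).norm.continuousOn
    refine ⟨_, norm_pos_iff.2 (hν.fourierMeasure_ne_zero (by omega) hAB (t := u) ?_), hmin⟩
    rw [abs_lt]
    constructor <;> linarith [hu.1, hu.2]
  have hsub : ∀ s : Finset (digitUnion n S), ∃ k, ∀ l ∈ s, (l : ℤ) ∈ digitSet n S k := by
    intro s
    choose K hK using fun l : digitUnion n S => l.2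
    exact ⟨s.sup K, fun l hl => h.digitSet_mono (Finset.le_sup hl) (hK l)⟩
  have hle : ∀ k u, ‖fourierMeasure ν u‖ ^ 2 ≤ ‖maskProd A n k u‖ ^ 2 := by
    intro k u
    rw [hν.fourierMeasure_eq_maskProd (by omega) k u, norm_mul]
    gcongr
    exact mul_le_of_le_one_right (norm_nonneg _) (norm_fourierMeasure_le_one _ _)
  have hsumm : Summable (fun l : digitUnion n S => ‖fourierMeasure ν (t + (l : ℤ))‖ ^ 2) := by
    refine summable_of_sum_le (c := 1) (fun _ => by positivity) fun s => ?_
    obtain ⟨k, hk⟩ := hsub s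
    calc _ = ∑ l ∈ s.map (Function.Embedding.subtype _), ‖fourierMeasure ν (t + l)‖ ^ 2 := by
          rw [Finset.sum_map]; rfl
      _ ≤ ∑ l ∈ digitSet n S k, ‖fourierMeasure ν (t + l)‖ ^ 2 := by
          refine Finset.sum_le_sum_of_subset_of_nonneg (fun l hl => ?_) fun _ _ _ => by positivity
          obtain ⟨l', hl', rfl⟩ := Finset.mem_map.1 hl
          exact hk l' hl'
      _ ≤ ∑ l ∈ digitSet n S k, ‖maskProd A n k (t + l)‖ ^ 2 :=
          Finset.sum_le_sum fun l _ => hle k _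
      _ = 1 := h.sum_sq_norm_maskProd (by omega) hA k t
  classical
  let F : ℕ → digitUnion n S → ℝ := fun k l =>
    if (l : ℤ) ∈ digitSet n S k then ‖maskProd A n k (t + (l : ℤ))‖ ^ 2 else 0
  have hF1 : ∀ k, ∑' l, F k l = 1 := by
    intro k
    rw [← h.sum_sq_norm_maskProd (by omega) hA k t]
    have hin : ∀ l ∈ digitSet n S k, l ∈ digitUnion n S := fun l hl => ⟨k, hl⟩
    rw [tsum_eq_sum (s := (digitSet n S k).subtype (· ∈ digitUnion n S))]
    · rw [← Finset.sum_subtype_of_mem (fun l : ℤ => ‖maskProd A n k (t + l)‖ ^ 2) hin]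
      refine Finset.sum_congr rfl fun l hl => ?_
      simp only [F]
      rw [if_pos (Finset.mem_subtype.1 hl)]
    · intro l hl
      simp only [F]
      rw [if_neg (fun hc => hl (Finset.mem_subtype.2 hc))]
  have hlim : ∀ l, Filter.Tendsto (fun k => F k l) Filter.atTop
      (nhds (‖fourierMeasure ν (t + (l : ℤ))‖ ^ 2)) := by
    intro l
    refine (((hν.tendsto_maskProd (by omega) (t + (l : ℤ))).norm).pow 2).congr' ?_
    obtain ⟨K, hK⟩ := l.2
    filter_upwards [Filter.eventually_ge_atTop K] with k hk
    simp only [F]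
    rw [if_pos (h.digitSet_mono hk hK)]
  have hdom : ∀ᶠ k in Filter.atTop, ∀ l, ‖F k l‖ ≤
      (c ^ 2)⁻¹ * ‖fourierMeasure ν (t + (l : ℤ))‖ ^ 2 := by
    have ht := (tendsto_div_pow_atTop_zero (n := n) (by omega) |t|).eventually_lt_const
      (show (0 : ℝ) < 1 / 6 by norm_num)
    filter_upwards [ht] with k hk l
    simp only [F]
    split_ifs with hl
    · have hpow : (0 : ℝ) < n ^ k := by positivity
      have hmem : (t + (l : ℤ)) / (n : ℝ) ^ k ∈ Set.Icc (-(5 / 6) : ℝ) (5 / 6) := by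
        rw [Set.mem_Icc, ← abs_le, abs_div, abs_of_pos hpow, div_le_iff₀ hpow]
        rw [div_lt_iff₀ hpow] at hk
        have h1 := abs_le_of_mem_digitSet hn hS k l hl
        have h2 := abs_add_le t ((l : ℤ) : ℝ)
        linarith
      have h1 := hcle _ hmem
      rw [hν.fourierMeasure_eq_maskProd (by omega) k, norm_mul, mul_pow, norm_pow, norm_norm,
        inv_mul_eq_div, le_div_iff₀ (by positivity)]
      gcongr
    · simp only [norm_zero]
      positivity
  have := tendsto_tsum_of_dominated_convergence (hsumm.mul_left _) hlim hdom
  simp only [hF1] at this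
  rw [← tendsto_nhds_unique this tendsto_const_nhds]
  exact hsumm.hasSum

/-- Every translate of `digitUnion n S` is a spectrum of the self-similar measure. -/
theorem IsDual.exists_hilbertBasis {A B : Finset ℕ} {n : ℕ} {S : Finset ℤ}
    {ν : Measure ℝ} (h : IsDual A n S) (hn : 4 ≤ n) (hAB : IsDirectSumRange A B n)
    (hS : ∀ s ∈ S, |(s : ℝ)| ≤ n / 2)
    [IsProbabilityMeasure ν] (hν : IsSelfSimilar A n ν) (θ : ℝ) :
    ∃ b : HilbertBasis (digitUnion n S) ℂ (Lp ℂ 2 ν), ∀ l, b l = expL2 ν (θ + (l : ℤ)) := by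
  have hv : Orthonormal ℂ (fun l : digitUnion n S => expL2 ν (θ + (l : ℤ))) := by
    refine ⟨fun l => norm_expL2 _ _, fun l l' hne => ?_⟩
    obtain ⟨k, hk⟩ := l.2
    obtain ⟨k', hk'⟩ := l'.2
    change inner ℂ (expL2 ν _) (expL2 ν _) = 0
    rw [inner_expL2, add_sub_add_left_eq_sub]
    exact h.fourierMeasure_eq_zero (by omega) hν (max k k') _
      (h.digitSet_mono (le_max_right _ _) hk') _ (h.digitSet_mono (le_max_left _ _) hk)
      (fun e => hne (Subtype.ext e.symm))
  refine ⟨HilbertBasis.mkOfOrthogonalEqBot hv ?_, fun l => ?_⟩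
  · rw [Submodule.eq_bot_iff]
    intro f hf
    refine eq_zero_of_inner_expL2_eq_zero f fun t => ?_
    refine hv.inner_eq_zero_of_hasSum ?_ fun l =>
      (Submodule.mem_orthogonal _ _).1 hf _ (Submodule.subset_span ⟨l, rfl⟩)
    rw [norm_expL2, one_pow]
    convert h.hasSum_sq_norm_fourierMeasure hn hAB hS hν (θ - t) using 3 with l
    rw [← inner_conj_symm, RCLike.norm_conj, inner_expL2]
    congr 2
    ring
  · rw [HilbertBasis.coe_mkOfOrthogonalEqBot]

/-! ### Riesz bases glued from orthonormal bases -/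

theorem hasSum_prod_of_fintype {J L E : Type*} [Fintype J] [AddCommMonoid E] [TopologicalSpace E]
    [ContinuousAdd E] {F : J × L → E} {s : J → E} (h : ∀ j, HasSum (fun l => F (j, l)) (s j)) :
    HasSum F (∑ j, s j) := by
  classical
  have h1 : ∀ j, HasSum (fun x : J × L => if x.1 = j then F x else 0) (s j) := by
    intro j
    have hinj : Function.Injective (fun l : L => (j, l)) := fun l l' hl => by simpa using hl
    refine (hinj.hasSum_iff ?_).1 ?_
    · rintro ⟨i, l⟩ hx
      refine if_neg ?_
      rintro rfl
      exact hx ⟨l, rfl⟩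
    · simpa [Function.comp_def] using h j
  have h2 := hasSum_sum (fun j (_ : j ∈ Finset.univ) => h1 j)
  simpa using h2

theorem HilbertBasis.hasSum_sq_norm_inner {ι H : Type*} [NormedAddCommGroup H]
    [InnerProductSpace ℂ H] (b : HilbertBasis ι ℂ H) (x : H) :
    HasSum (fun i => ‖inner ℂ (b i) x‖ ^ 2) (‖x‖ ^ 2) := by
  have h := b.hasSum_inner_mul_inner x x
  rw [inner_self_eq_ofReal_norm_sq] at h
  rw [← Complex.hasSum_ofReal]
  refine h.congr_fun fun i => ?_
  rw [← inner_conj_symm x (b i), Complex.conj_mul', Complex.ofReal_pow]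

section Gluing

open ContinuousLinearMap

variable {J L H G : Type*} [Fintype J] [NormedAddCommGroup H] [InnerProductSpace ℂ H]
  [NormedAddCommGroup G] [InnerProductSpace ℂ G]

/-- An isomorphism `W : G^J → H` with inverse `Z` maps an orthonormal basis which is composed of
orthonormal bases of the factors to a basis. -/
theorem existsUnique_hasSum_of_hilbertBasis (W : J → G →L[ℂ] H) (Z : J → H →L[ℂ] G)
    (hWZ : ∀ f, ∑ j, W j (Z j f) = f) (hZW : ∀ i j g, i ≠ j → Z i (W j g) = 0)
    (hZW' : ∀ j g, Z j (W j g) = g) (b : J → HilbertBasis L ℂ G) (f : H) :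
    ∃! c : J × L → ℂ, HasSum (fun x => c x • W x.1 (b x.1 x.2)) f := by
  classical
  refine ⟨fun x => inner ℂ (b x.1 x.2) (Z x.1 f), ?_, fun c hc => ?_⟩
  · have h1 : ∀ j, HasSum (fun l => inner ℂ (b j l) (Z j f) • W j (b j l)) (W j (Z j f)) := by
      intro j
      have h2 := (W j).hasSum ((b j).hasSum_repr (Z j f))
      simpa only [map_smul, HilbertBasis.repr_apply_apply] using h2
    have h2 := hasSum_prod_of_fintype
      (F := fun x : J × L => inner ℂ (b x.1 x.2) (Z x.1 f) • W x.1 (b x.1 x.2)) h1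
    rwa [hWZ] at h2
  · ext ⟨i, l⟩
    have h1 := (innerSL ℂ (b i l)).hasSum ((Z i).hasSum hc)
    simp only [innerSL_apply_apply, map_smul] at h1
    have h2 : HasSum (fun x : J × L => c x • inner ℂ (b i l) (Z i (W x.1 (b x.1 x.2))))
        (c (i, l)) := by
      have h3 := hasSum_single (f := fun x : J × L =>
        c x • inner ℂ (b i l) (Z i (W x.1 (b x.1 x.2)))) (i, l) ?_
      · have h4 := inner_self_eq_ofReal_norm_sq (b i l)
        simp only [hZW', h4, (b i).orthonormal.1 l] at h3
        simpa using h3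
      · rintro ⟨j, l'⟩ hne
        by_cases hij : i = j
        · subst hij
          have hll : l ≠ l' := by rintro rfl; exact hne rfl
          simp only [hZW', (b i).orthonormal.2 hll, smul_zero]
        · simp only [hZW i j _ hij, inner_zero_right, smul_zero]
    exact h2.unique h1

variable [CompleteSpace H] [CompleteSpace G]

/-- An isomorphism `W : G^J → H` with inverse `Z` maps an orthonormal basis which is composed of
orthonormal bases of the factors to a frame: the analysis operator of the image is `f ↦ (W j)† f`,
bounded from below because `‖f‖² = ∑ ⟨(W j)† f, Z j f⟩`. -/
theorem exists_frame_bounds_of_hilbertBasis (W : J → G →L[ℂ] H) (Z : J → H →L[ℂ] G)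
    (hWZ : ∀ f, ∑ j, W j (Z j f) = f) (b : J → HilbertBasis L ℂ G) :
    ∃ A B : ℝ, 0 < A ∧ 0 < B ∧ ∀ f : H,
      Summable (fun x : J × L => ‖inner ℂ (W x.1 (b x.1 x.2)) f‖ ^ 2) ∧
      A * ‖f‖ ^ 2 ≤ ∑' x : J × L, ‖inner ℂ (W x.1 (b x.1 x.2)) f‖ ^ 2 ∧
      ∑' x : J × L, ‖inner ℂ (W x.1 (b x.1 x.2)) f‖ ^ 2 ≤ B * ‖f‖ ^ 2 := by
  set M := ∑ j, ‖Z j‖ ^ 2 with hM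
  have hM0 : 0 ≤ M := Finset.sum_nonneg fun _ _ => by positivity
  have hN0 : 0 ≤ ∑ j, ‖adjoint (W j)‖ ^ 2 := Finset.sum_nonneg fun _ _ => by positivity
  refine ⟨(M + 1)⁻¹, (∑ j, ‖adjoint (W j)‖ ^ 2) + 1, by positivity, by positivity, fun f => ?_⟩
  have h1 : HasSum (fun x : J × L => ‖inner ℂ (W x.1 (b x.1 x.2)) f‖ ^ 2)
      (∑ j, ‖adjoint (W j) f‖ ^ 2) := by
    refine hasSum_prod_of_fintype fun j => ?_
    simpa only [adjoint_inner_right] using (b j).hasSum_sq_norm_inner (adjoint (W j) f)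
  refine ⟨h1.summable, ?_, ?_⟩
  · rw [h1.tsum_eq]
    have h2 : ‖f‖ ^ 2 ≤ ∑ j, ‖adjoint (W j) f‖ * (‖Z j‖ * ‖f‖) := by
      have e : inner ℂ f f = ∑ j, inner ℂ (adjoint (W j) f) (Z j f) := by
        conv_lhs => arg 3; rw [← hWZ f]
        simp only [inner_sum, adjoint_inner_left]
      have e2 : ‖f‖ ^ 2 = ‖inner ℂ f f‖ := by
        rw [inner_self_eq_ofReal_norm_sq, Complex.norm_real, Real.norm_of_nonneg (by positivity)]
      rw [e2, e]
      refine (norm_sum_le _ _).trans (Finset.sum_le_sum fun j _ => ?_)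
      refine (norm_inner_le_norm _ _).trans ?_
      gcongr
      exact (Z j).le_opNorm f
    have h3 := Finset.sum_mul_sq_le_sq_mul_sq Finset.univ (fun j => ‖adjoint (W j) f‖)
      (fun j => ‖Z j‖ * ‖f‖)
    simp only [mul_pow] at h3
    rw [← Finset.sum_mul, ← hM] at h3
    set T := ∑ j, ‖adjoint (W j) f‖ ^ 2
    have hT : 0 ≤ T := Finset.sum_nonneg fun _ _ => by positivity
    have h4 : (‖f‖ ^ 2) * ‖f‖ ^ 2 ≤ T * M * ‖f‖ ^ 2 := by
      calc (‖f‖ ^ 2) * ‖f‖ ^ 2 = (‖f‖ ^ 2) ^ 2 := by ring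
        _ ≤ (∑ j, ‖adjoint (W j) f‖ * (‖Z j‖ * ‖f‖)) ^ 2 := by gcongr
        _ ≤ _ := by rw [mul_assoc]; exact h3
    rw [inv_mul_le_iff₀ (by positivity)]
    rcases (sq_nonneg ‖f‖).eq_or_lt with h0 | h0
    · rw [← h0]; positivity
    · have := le_of_mul_le_mul_right h4 h0
      nlinarith
  · rw [h1.tsum_eq, add_mul, Finset.sum_mul]
    refine le_add_of_le_of_nonneg (Finset.sum_le_sum fun j _ => ?_) (by positivity)
    rw [← mul_pow]
    gcongr
    exact (adjoint (W j)).le_opNorm f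

/-- Restriction operators `R j` which decompose `H` into a sum of copies of `G`, weighted by `p`,
come with extension operators. -/
theorem exists_extension {p : J → ℝ} (R : J → H →L[ℂ] G)
    (hR : ∀ f h, ∑ j, (p j : ℂ) * inner ℂ (R j f) (R j h) = inner ℂ f h)
    (hsurj : ∀ j g, ∃ f, R j f = g ∧ ∀ i ≠ j, R i f = 0) :
    ∃ E : J → G →L[ℂ] H, (∀ f, ∑ j, E j (R j f) = f) ∧ (∀ j g, R j (E j g) = g) ∧
      (∀ i j g, i ≠ j → R i (E j g) = 0) ∧
      ∀ j f g, inner ℂ f (E j g) = p j * inner ℂ (R j f) g := by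
  let E : J → G →L[ℂ] H := fun j => (p j : ℂ) • adjoint (R j)
  have hE : ∀ j f g, inner ℂ f (E j g) = p j * inner ℂ (R j f) g := fun j f g => by
    simp only [E, smul_apply, inner_smul_right, adjoint_inner_right]
  have hsum : ∀ f, ∑ j, E j (R j f) = f := fun f => by
    refine ext_inner_left ℂ fun h => ?_
    rw [inner_sum]
    simp only [hE, hR]
  have key : ∀ j g, R j (E j g) = g ∧ ∀ i ≠ j, R i (E j g) = 0 := by
    intro j g
    obtain ⟨f, hf1, hf2⟩ := hsurj j g
    have : E j g = f := by
      rw [← hsum f, Finset.sum_eq_single j, hf1]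
      · intro i _ hij
        rw [hf2 i hij, map_zero]
      · exact fun h => absurd (Finset.mem_univ j) h
    rw [this]
    exact ⟨hf1, hf2⟩
  exact ⟨E, hsum, fun j g => (key j g).1, fun i j g hij => (key j g).2 i hij, hE⟩

end Gluing

/-! ### Convolution with a discrete measure -/

theorem discreteMeasure_conv (C : Finset ℕ) (p : ℕ → ℝ) (ν : Measure ℝ) [SFinite ν] :
    Measure.conv (discreteMeasure C p) ν =
      ∑ c ∈ C, ENNReal.ofReal (p c) • ν.map (fun x => (c : ℝ) + x) := by
  classical
  induction C using Finset.induction_on with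
  | empty => simp [discreteMeasure, Measure.zero_conv]
  | insert c C hc ih =>
    have h : discreteMeasure (insert c C) p =
        ENNReal.ofReal (p c) • Measure.dirac (c : ℝ) + discreteMeasure C p :=
      Finset.sum_insert hc
    have : IsFiniteMeasure (ENNReal.ofReal (p c) • Measure.dirac (c : ℝ)) :=
      Measure.smul_finite _ ENNReal.ofReal_ne_top
    rw [Finset.sum_insert hc, h, Measure.add_conv, ih, Measure.conv_smul_left,
      Measure.dirac_conv]

theorem discreteMeasure_conv_apply (C : Finset ℕ) (p : ℕ → ℝ) (ν : Measure ℝ) [SFinite ν]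
    {E : Set ℝ} (hE : MeasurableSet E) :
    Measure.conv (discreteMeasure C p) ν E =
      ∑ c ∈ C, ENNReal.ofReal (p c) * ν ((fun x => (c : ℝ) + x) ⁻¹' E) := by
  rw [discreteMeasure_conv, Measure.finsetSum_apply]
  refine Finset.sum_congr rfl fun c _ => ?_
  rw [Measure.smul_apply, Measure.map_apply (by fun_prop) hE, smul_eq_mul]

theorem isProbabilityMeasure_discreteMeasure {C : Finset ℕ} {p : ℕ → ℝ} (hp : ∀ c ∈ C, 0 < p c)
    (hp1 : ∑ c ∈ C, p c = 1) : IsProbabilityMeasure (discreteMeasure C p) := by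
  refine ⟨?_⟩
  simp only [discreteMeasure, Measure.finsetSum_apply, Measure.smul_apply, measure_univ,
    smul_eq_mul, mul_one]
  rw [← ENNReal.ofReal_sum_of_nonneg fun c hc => (hp c hc).le, hp1, ENNReal.ofReal_one]

theorem isCompact_support_discreteMeasure_conv (C : Finset ℕ) (p : ℕ → ℝ) {ν : Measure ℝ}
    [SFinite ν] (h : ν (Set.Icc 0 1)ᶜ = 0) :
    IsCompact (Measure.conv (discreteMeasure C p) ν).support := by
  have hF : IsCompact (⋃ c ∈ C, Set.Icc (c : ℝ) (c + 1)) :=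
    C.isCompact_biUnion fun c _ => isCompact_Icc
  refine hF.of_isClosed_subset Measure.isClosed_support
    (Measure.support_subset_of_isClosed hF.isClosed (mem_ae_iff.2 ?_))
  rw [discreteMeasure_conv_apply _ _ _ hF.isClosed.isOpen_compl.measurableSet]
  refine Finset.sum_eq_zero fun c hc => ?_
  rw [measure_mono_null _ h, mul_zero]
  intro x hx hx'
  exact hx (Set.mem_biUnion hc ⟨by linarith [hx'.1], by linarith [hx'.2]⟩)

theorem isSingularlyContinuous_discreteMeasure_conv (C : Finset ℕ) (p : ℕ → ℝ) {ν : Measure ℝ}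
    [SFinite ν] (h : IsSingularlyContinuous ν) :
    IsSingularlyContinuous (Measure.conv (discreteMeasure C p) ν) := by
  constructor
  · intro x
    rw [discreteMeasure_conv_apply _ _ _ (measurableSet_singleton x)]
    refine Finset.sum_eq_zero fun c _ => ?_
    have : (fun y => (c : ℝ) + y) ⁻¹' {x} = {x - c} := by
      ext y
      simp only [Set.mem_preimage, Set.mem_singleton_iff]
      constructor <;> intro h <;> linarith
    rw [this, h.1, mul_zero]
  · obtain ⟨s, hs, hs1, hs2⟩ := h.2
    have hsing : ∀ c : ℝ, (ν.map (fun x => c + x)).MutuallySingular volume := by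
      intro c
      have hm : Measurable fun x : ℝ => -c + x := by fun_prop
      refine ⟨(fun x => -c + x) ⁻¹' s, hm hs, ?_, ?_⟩
      · rw [Measure.map_apply (by fun_prop) (hm hs), ← Set.preimage_comp]
        convert hs1
        ext x
        simp
      · rw [← Set.preimage_compl, measure_preimage_add, hs2]
    rw [discreteMeasure_conv]
    clear hs1 hs2
    induction C using Finset.cons_induction with
    | empty => simp
    | cons c C hc ih =>
      rw [Finset.sum_cons]
      exact ((hsing c).smul _).add_left ih

/-- Translation by `c` followed by restriction is bounded from `L²(μ)` to `L²(ν)` if `μ` dominates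
the translate of `ν` by `c` up to a constant. -/
theorem exists_translation_operator {μ ν : Measure ℝ} {K : ENNReal} (hK : K ≠ ⊤) (c : ℝ)
    (h : ν.map (fun x => c + x) ≤ K • μ) :
    ∃ R : Lp ℂ 2 μ →L[ℂ] Lp ℂ 2 ν, ∀ f : Lp ℂ 2 μ, R f =ᵐ[ν] fun x => f (c + x) := by
  have hm : Measurable fun x : ℝ => c + x := by fun_prop
  have hac : ν.map (fun x => c + x) ≪ μ := Measure.absolutelyContinuous_of_le_smul h
  have hae : ∀ {P : ℝ → Prop}, (∀ᵐ x ∂μ, P x) → ∀ᵐ x ∂ν, P (c + x) := fun hP =>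
    ae_of_ae_map hm.aemeasurable (hac.ae_le hP)
  have hmem : ∀ f : Lp ℂ 2 μ, MemLp (fun x => f (c + x)) 2 ν := fun f =>
    (MemLp.comp_of_map ((Lp.memLp f).of_measure_le_smul hK h) hm.aemeasurable)
  let R : Lp ℂ 2 μ →ₗ[ℂ] Lp ℂ 2 ν :=
    { toFun := fun f => (hmem f).toLp _
      map_add' := fun f g => by
        rw [← MemLp.toLp_add (hmem f) (hmem g)]
        exact MemLp.toLp_congr _ _ (hae (Lp.coeFn_add f g))
      map_smul' := fun a f => by
        rw [RingHom.id_apply, ← MemLp.toLp_const_smul]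
        exact MemLp.toLp_congr _ _ (hae (Lp.coeFn_smul a f)) }
  have hbound : ∀ f, ‖R f‖ ≤ (K ^ (1 / (2 : ENNReal)).toReal).toReal * ‖f‖ := by
    intro f
    change ‖(hmem f).toLp _‖ ≤ _
    rw [Lp.norm_toLp, Lp.norm_def, ← ENNReal.toReal_mul]
    refine ENNReal.toReal_mono (ENNReal.mul_ne_top
      (ENNReal.rpow_ne_top_of_nonneg (by positivity) hK) (Lp.memLp f).eLpNorm_ne_top) ?_
    rw [show (fun x => f (c + x)) = f ∘ (fun x => c + x) from rfl,
      ← eLpNorm_map_measure ((Lp.aestronglyMeasurable f).mono_ac hac) hm.aemeasurable]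
    exact eLpNorm_le_of_measure_le_smul h
  exact ⟨R.mkContinuous _ hbound, fun f => MemLp.coeFn_toLp (hmem f)⟩

/-- The restriction operators `f ↦ f (c + ·)` from `L²(μ)` to `L²(ν)`, `c ∈ C`, where
`μ = η * ν`. They are
jointly onto because the translates `c + [0, 1)` are disjoint. -/
theorem exists_restriction {C : Finset ℕ} {p : ℕ → ℝ} (hp : ∀ c ∈ C, 0 < p c) {μ ν : Measure ℝ}
    [IsFiniteMeasure μ] [IsFiniteMeasure ν]
    (hμ : μ = ∑ c ∈ C, ENNReal.ofReal (p c) • ν.map (fun x => (c : ℝ) + x))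
    (hν : ν (Set.Ico 0 1)ᶜ = 0) :
    ∃ R : C → Lp ℂ 2 μ →L[ℂ] Lp ℂ 2 ν,
      (∀ f h, ∑ c : C, (p c : ℂ) * inner ℂ (R c f) (R c h) = inner ℂ f h) ∧
      (∀ c g, ∃ f, R c f = g ∧ ∀ d ≠ c, R d f = 0) ∧
      ∀ c t, R c (expL2 μ t) = expFun t (c : ℕ) • expL2 ν t := by
  have hpc : ∀ c : C, ENNReal.ofReal (p c) ≠ 0 := fun c => by
    simpa using hp c c.2
  have hle : ∀ c : C, ν.map (fun x => ((c : ℕ) : ℝ) + x) ≤ (ENNReal.ofReal (p c))⁻¹ • μ := by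
    intro c
    have h1 : ENNReal.ofReal (p c) • ν.map (fun x => ((c : ℕ) : ℝ) + x) ≤ μ := by
      conv_rhs => rw [hμ]
      exact Finset.single_le_sum
        (f := fun c : ℕ => ENNReal.ofReal (p c) • ν.map (fun x => (c : ℝ) + x))
        (fun _ _ => Measure.zero_le _) c.2
    intro E
    have h2 := h1 E
    rw [Measure.smul_apply, smul_eq_mul] at h2 ⊢
    calc ν.map (fun x => ((c : ℕ) : ℝ) + x) E = (ENNReal.ofReal (p c))⁻¹ *
          (ENNReal.ofReal (p c) * ν.map (fun x => ((c : ℕ) : ℝ) + x) E) := by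
          rw [← mul_assoc, ENNReal.inv_mul_cancel (hpc c) ENNReal.ofReal_ne_top, one_mul]
      _ ≤ _ := by gcongr
  choose R hR using fun c : C => exists_translation_operator
    (ENNReal.inv_ne_top.2 (hpc c)) ((c : ℕ) : ℝ) (hle c)
  have hac : ∀ c : C, ν.map (fun x => ((c : ℕ) : ℝ) + x) ≪ μ := fun c =>
    Measure.absolutelyContinuous_of_le_smul (hle c)
  have hae : ∀ (c : C) {P : ℝ → Prop}, (∀ᵐ x ∂μ, P x) → ∀ᵐ x ∂ν, P ((c : ℕ) + x) :=
    fun c _ hP => ae_of_ae_map (by fun_prop) ((hac c).ae_le hP)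
  refine ⟨R, fun f h => ?_, fun c g => ?_, fun c t => ?_⟩
  · have hint : Integrable (fun x => inner ℂ (f x) (h x)) μ := L2.integrable_inner f h
    rw [L2.inner_def]
    have hint' : ∀ k : ℝ → ℂ, Integrable k μ → ∀ c ∈ C, Integrable k
        (ENNReal.ofReal (p c) • ν.map (fun x => (c : ℝ) + x)) := fun k hk => by
      rwa [hμ, integrable_finsetSum_measure] at hk
    have hsum : ∫ x, inner ℂ (f x) (h x) ∂μ = ∫ x, inner ℂ (f x) (h x)
        ∂(∑ c ∈ C, ENNReal.ofReal (p c) • ν.map (fun x => (c : ℝ) + x)) := by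
      congr 1
    rw [hsum, integral_finsetSum_measure (hint' _ hint), ← Finset.sum_coe_sort C]
    refine Finset.sum_congr rfl fun c _ => ?_
    rw [integral_smul_measure, ENNReal.toReal_ofReal (hp c c.2).le, Complex.real_smul,
      integral_map (by fun_prop) (hint.1.mono_ac (hac c)), L2.inner_def]
    congr 1
    refine integral_congr_ae ?_
    filter_upwards [hR c f, hR c h] with x hx hy
    rw [hx, hy]
  · let F : ℝ → ℂ := (Set.Ico ((c : ℕ) : ℝ) ((c : ℕ) + 1)).indicator fun x => g (x - (c : ℕ))
    have hFm : StronglyMeasurable F :=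
      ((Lp.stronglyMeasurable g).comp_measurable (by fun_prop)).indicator measurableSet_Ico
    have hin : ∀ᵐ x ∂ν, x ∈ Set.Ico (0 : ℝ) 1 := mem_ae_iff.2 hν
    have hFc : (fun x => F ((c : ℕ) + x)) =ᵐ[ν] g := by
      filter_upwards [hin] with x hx
      simp only [F]
      rw [Set.indicator_of_mem (Set.mem_Ico.2 ⟨by linarith [hx.1], by linarith [hx.2]⟩),
        add_sub_cancel_left]
    have hFd : ∀ d : ℕ, d ≠ c → (fun x => F (d + x)) =ᵐ[ν] 0 := by
      intro d hd
      filter_upwards [hin] with x hx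
      refine Set.indicator_of_notMem (fun hmem => hd ?_) _
      have h1 : (d : ℝ) < (c : ℕ) + 1 := by linarith [hx.1, hmem.2]
      have h2 : ((c : ℕ) : ℝ) < d + 1 := by linarith [hx.2, hmem.1]
      have h3 : d < (c : ℕ) + 1 := by exact_mod_cast h1
      have h4 : (c : ℕ) < d + 1 := by exact_mod_cast h2
      omega
    have hF : MemLp F 2 μ := by
      rw [memLp_two_iff_integrable_sq_norm hFm.aestronglyMeasurable, hμ,
        integrable_finsetSum_measure]
      intro d hd
      refine Integrable.smul_measure ?_ ENNReal.ofReal_ne_top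
      have hsq : StronglyMeasurable fun x => ‖F x‖ ^ 2 := hFm.norm.pow 2
      rw [integrable_map_measure hsq.aestronglyMeasurable (by fun_prop)]
      by_cases hdc : d = c
      · have h1 := (memLp_two_iff_integrable_sq_norm (Lp.aestronglyMeasurable g)).1 (Lp.memLp g)
        refine h1.congr ?_
        filter_upwards [hFc] with x hx
        rw [Function.comp_apply, hdc, hx]
      · refine (integrable_zero ℝ ℝ ν).congr ?_
        filter_upwards [hFd d hdc] with x hx
        simp [hx]
    have hRF : ∀ d : C, R d (hF.toLp F) =ᵐ[ν] fun x => F ((d : ℕ) + x) := fun d =>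
      (hR d _).trans (hae d hF.coeFn_toLp)
    refine ⟨hF.toLp F, Lp.ext ((hRF c).trans hFc), fun d hd => ?_⟩
    rw [Lp.eq_zero_iff_ae_eq_zero]
    exact (hRF d).trans (hFd d fun e => hd (Subtype.ext e))
  · refine Lp.ext ?_
    filter_upwards [hR c (expL2 μ t), hae c (expFun_memLp μ t).coeFn_toLp,
      (expFun_memLp ν t).coeFn_toLp,
      Lp.coeFn_smul (expFun t (c : ℕ)) (expL2 ν t)] with x h1 h2 h3 h4
    rw [h1, h4, Pi.smul_apply, expL2, h2, expL2, h3, expFun_add_right, smul_eq_mul]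

/-- For a spectrum `S`, Parseval's identity for the indicator function of `c + [0, 1)` shows that
`(p c)⁻¹ = ∑ |ν̂(t)|²`, the sum being over `t ∈ S`, so that `p c` does not depend on `c`. -/
theorem not_isSpectralMeasure_discreteMeasure_conv {C : Finset ℕ} {p : ℕ → ℝ}
    (hp : ∀ c ∈ C, 0 < p c) (hne : ∃ c ∈ C, ∃ c' ∈ C, p c ≠ p c') {ν : Measure ℝ}
    [IsProbabilityMeasure ν] (hν : ν (Set.Ico 0 1)ᶜ = 0) :
    ¬ IsSpectralMeasure (Measure.conv (discreteMeasure C p) ν) := by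
  rintro ⟨S, -, b, hb⟩
  obtain ⟨R, hR, hsurj, hexp⟩ := exists_restriction hp (discreteMeasure_conv C p ν) hν
  obtain ⟨E, -, hRE, -, hE⟩ := exists_extension (p := fun c : C => p c) R hR hsurj
  have key : ∀ c : C, HasSum (fun t : S => ‖inner ℂ (expL2 ν t) (expL2 ν 0)‖ ^ 2) (p c)⁻¹ := by
    intro c
    have hpc := hp c c.2
    set F := E c (expL2 ν 0) with hF
    have hnorm : ‖F‖ ^ 2 = p c := by
      have h1 := inner_self_eq_ofReal_norm_sq F
      conv_lhs at h1 => rw [hF]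
      rw [hE, hRE, inner_self_eq_ofReal_norm_sq, norm_expL2] at h1
      have h2 : (p c : ℂ) = ((‖F‖ ^ 2 : ℝ) : ℂ) := by simpa using h1
      exact_mod_cast h2.symm
    have hsum := (b.hasSum_sq_norm_inner F).mul_left ((p c)⁻¹ ^ 2)
    rw [hnorm] at hsum
    rw [show (p c)⁻¹ ^ 2 * p c = (p c)⁻¹ by field_simp] at hsum
    refine hsum.congr_fun fun t => ?_
    rw [hb, hF, hE, hexp, inner_smul_left, norm_mul, norm_mul, RCLike.norm_conj, norm_expFun,
      one_mul, Complex.norm_real, Real.norm_of_nonneg hpc.le]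
    field_simp
  obtain ⟨c, hc, c', hc', h⟩ := hne
  exact h (inv_injective ((key ⟨c, hc⟩).unique (key ⟨c', hc'⟩)))

/-- For equidistant `θ` with spacing `1 / N`, where `N` exceeds all `c ∈ C`, the matrix
`e^{2π i θ j c}` is of Vandermonde type with distinct nodes `e^{2π i c / N}`. -/
theorem exists_invertible_exponential_matrix (C : Finset ℕ) :
    ∃ (θ : C → ℝ) (V : C → C → ℂ), Function.Injective θ ∧ (∀ c, 0 ≤ θ c ∧ θ c < 1) ∧
      (∀ i j, ∑ c : C, V i c * expFun (θ j) (c : ℕ) = if i = j then 1 else 0) ∧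
      ∀ c d : C, ∑ j, V j d * expFun (θ j) (c : ℕ) = if c = d then 1 else 0 := by
  classical
  set N : ℕ := max C.card (C.sup id + 1) with hN
  have hNpos : 0 < N := lt_of_lt_of_le (Nat.succ_pos _) (le_max_right _ _)
  have hN0 : (N : ℝ) ≠ 0 := by exact_mod_cast hNpos.ne'
  let e : C ≃ Fin C.card := C.equivFin
  let θ : C → ℝ := fun c => ((e c : ℕ) : ℝ) / N
  let U : Matrix C C ℂ := fun c j => expFun (θ j) (c : ℕ)
  have hU : U = (Matrix.vandermonde fun i : Fin C.card =>
      expFun ((((e.symm i : C) : ℕ) : ℝ) / N) 1).submatrix e e := by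
    ext c j
    simp only [U, θ, Matrix.submatrix_apply, Matrix.vandermonde_apply, Equiv.symm_apply_apply,
      expFun_pow, mul_one]
    rw [expFun, expFun]
    congr 1
    push_cast
    ring
  have hdet : IsUnit U.det := by
    rw [hU, Matrix.det_submatrix_equiv_self, isUnit_iff_ne_zero, Matrix.det_vandermonde_ne_zero_iff]
    intro i j hij
    simp only at hij
    have h1 : expFun ((((e.symm i : C) : ℕ) : ℝ) / N - (((e.symm j : C) : ℕ) : ℝ) / N) 1 = 1 := by
      rw [sub_eq_add_neg, expFun_add, hij, ← expFun_add, add_neg_cancel, expFun_zero]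
    obtain ⟨k, hk⟩ := (expFun_one_right_eq_one_iff _).1 h1
    have hlt : ∀ c : C, (c : ℕ) < N := fun c =>
      lt_of_lt_of_le (Nat.lt_succ_of_le (Finset.le_sup (f := id) c.2)) (le_max_right _ _)
    have h2 := hlt (e.symm i)
    have h3 := hlt (e.symm j)
    rw [← sub_div, div_eq_iff hN0] at hk
    have h4 : (((e.symm i : C) : ℕ) : ℤ) - ((e.symm j : C) : ℕ) = k * N := by exact_mod_cast hk
    have h5 := Int.eq_zero_of_abs_lt_dvd (m := (N : ℤ))
      (x := (((e.symm i : C) : ℕ) : ℤ) - ((e.symm j : C) : ℕ))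
      ⟨k, by rw [h4, mul_comm]⟩ (by rw [abs_lt]; omega)
    exact e.symm.injective (Subtype.ext (by omega))
  refine ⟨θ, fun i j => U⁻¹ i j, fun c d hcd => ?_, fun c => ⟨by positivity, ?_⟩,
    fun i j => ?_, fun c d => ?_⟩
  · simp only [θ] at hcd
    rw [div_left_inj' hN0] at hcd
    exact e.injective (Fin.ext (by exact_mod_cast hcd))
  · rw [div_lt_one (by positivity)]
    exact_mod_cast lt_of_lt_of_le (e c).2 (le_max_left _ _)
  · have := congrFun (congrFun (Matrix.nonsing_inv_mul U hdet) i) j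
    rwa [Matrix.mul_apply, Matrix.one_apply] at this
  · have := congrFun (congrFun (Matrix.mul_nonsing_inv U hdet) c) d
    rw [Matrix.mul_apply, Matrix.one_apply] at this
    rw [← this]
    exact Finset.sum_congr rfl fun j _ => mul_comm _ _

/-- If all translates of a set `Λ` of integers are spectra of `ν`, a measure on `[0, 1)`, then
`μ = η * ν` has an R-spectrum of the form `⋃ c, (θ c + Λ)`. The numbers `θ c` are chosen such that
the matrix with entries `e^{2π i θ c d}` is invertible. -/
theorem isRSpectralMeasure_discreteMeasure_conv {C : Finset ℕ} {p : ℕ → ℝ}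
    (hp : ∀ c ∈ C, 0 < p c) {μ ν : Measure ℝ} [IsFiniteMeasure μ] [IsFiniteMeasure ν]
    (hμ : μ = ∑ c ∈ C, ENNReal.ofReal (p c) • ν.map (fun x => (c : ℝ) + x))
    (hν : ν (Set.Ico 0 1)ᶜ = 0)
    (Λ : Set ℤ) (hΛ : ∀ θ : ℝ, ∃ b : HilbertBasis Λ ℂ (Lp ℂ 2 ν),
      ∀ l, b l = expL2 ν (θ + (l : ℤ))) :
    IsRSpectralMeasure μ := by
  obtain ⟨R, hR, hsurj, hexp⟩ := exists_restriction hp hμ hν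
  obtain ⟨E, hER, hRE, hRE', -⟩ := exists_extension (p := fun c : C => p c) R hR hsurj
  obtain ⟨θ, V, hθ, hθ1, hVU, hUV⟩ := exists_invertible_exponential_matrix C
  choose b hb using fun c => hΛ (θ c)
  let W : C → Lp ℂ 2 ν →L[ℂ] Lp ℂ 2 μ := fun j => ∑ c : C, expFun (θ j) (c : ℕ) • E c
  let Z : C → Lp ℂ 2 μ →L[ℂ] Lp ℂ 2 ν := fun j => ∑ c : C, V j c • R c
  have hRW : ∀ c j g, R c (W j g) = expFun (θ j) (c : ℕ) • g := by
    intro c j g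
    simp only [W, sum_apply, smul_apply, map_sum, map_smul]
    rw [Finset.sum_eq_single c, hRE]
    · intro d _ hd
      rw [hRE' c d g (Ne.symm hd), smul_zero]
    · exact fun h => absurd (Finset.mem_univ c) h
  have hZW : ∀ i j g, Z i (W j g) = (if i = j then (1 : ℂ) else 0) • g := by
    intro i j g
    rw [← hVU i j, Finset.sum_smul]
    simp only [Z, sum_apply, smul_apply, hRW, smul_smul]
  have hWZ : ∀ f, ∑ j, W j (Z j f) = f := by
    intro f
    conv_rhs => rw [← hER f]
    simp only [W, Z, sum_apply, smul_apply, map_sum,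
      map_smul, Finset.smul_sum, smul_smul]
    rw [Finset.sum_comm]
    refine Finset.sum_congr rfl fun c _ => ?_
    rw [Finset.sum_comm]
    simp only [← Finset.sum_smul]
    rw [Finset.sum_eq_single c]
    · have := hUV c c
      rw [if_pos rfl] at this
      simp only [this, one_smul]
    · intro d _ hd
      have := hUV d c
      rw [if_neg hd] at this
      rw [this, zero_smul]
    · exact fun h => absurd (Finset.mem_univ c) h
  have hWb : ∀ j (l : Λ), W j (b j l) = expL2 μ (θ j + (l : ℤ)) := by
    intro j l
    rw [← hER (expL2 μ (θ j + (l : ℤ))), hb]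
    simp only [W, sum_apply, smul_apply, hexp, map_smul]
    refine Finset.sum_congr rfl fun c _ => ?_
    have := expFun_intCast l (c : ℕ)
    rw [Int.cast_natCast] at this
    rw [expFun_add, this, mul_one]
  have hinj : Function.Injective (fun x : C × Λ => θ x.1 + ((x.2 : ℤ) : ℝ)) := by
    rintro ⟨i, l⟩ ⟨j, m⟩ h
    simp only at h
    have h1 := hθ1 i
    have h2 := hθ1 j
    have h3 : ((l : ℤ) : ℝ) < (m : ℤ) + 1 := by linarith
    have h4 : ((m : ℤ) : ℝ) < (l : ℤ) + 1 := by linarith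
    have h5 : (l : ℤ) < (m : ℤ) + 1 := by exact_mod_cast h3
    have h6 : (m : ℤ) < (l : ℤ) + 1 := by exact_mod_cast h4
    have h7 : l = m := Subtype.ext (by omega)
    subst h7
    rw [hθ (add_right_cancel h)]
  let e : C × Λ ≃ Set.range (fun x : C × Λ => θ x.1 + ((x.2 : ℤ) : ℝ)) :=
    Equiv.ofInjective _ hinj
  have he : ∀ x : C × Λ, expL2 μ (e x) = W x.1 (b x.1 x.2) := fun x => (hWb x.1 x.2).symm
  refine ⟨Set.range (fun x : C × Λ => θ x.1 + ((x.2 : ℤ) : ℝ)),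
    ⟨Set.countable_range _, ?_⟩, fun f => ?_⟩
  · obtain ⟨A, B, hA, hB, h⟩ := exists_frame_bounds_of_hilbertBasis W Z hWZ b
    refine ⟨A, B, hA, hB, fun f => ?_⟩
    obtain ⟨h1, h2, h3⟩ := h f
    simp only [← he] at h1 h2 h3
    rw [← e.summable_iff, ← e.tsum_eq]
    exact ⟨h1, h2, h3⟩
  · obtain ⟨c, hc, huniq⟩ := existsUnique_hasSum_of_hilbertBasis W Z hWZ
      (fun i j g hij => by rw [hZW, if_neg hij, zero_smul])
      (fun j g => by rw [hZW, if_pos rfl, one_smul]) b f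
    simp only [← he] at hc huniq
    refine ⟨c ∘ e.symm, ?_, fun c' hc' => ?_⟩
    · refine (e.hasSum_iff (f := fun t => (c ∘ e.symm) t • expL2 μ t)).1 ?_
      simpa only [Function.comp_def, Equiv.symm_apply_apply] using hc
    · have h1 : HasSum (fun x => (c' ∘ e) x • expL2 μ (e x)) f :=
        (e.hasSum_iff (f := fun t => c' t • expL2 μ t)).2 hc'
      rw [← huniq (c' ∘ e) h1]
      ext t
      simp

/-! ### The singularly continuous R-spectral measures -/

theorem discreteMeasure_conv_selfSimilar {n : ℕ} {A B : Finset ℕ} (hAB : IsDirectSumRange A B n)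
    (hgcd : A.gcd id = 1) (hAn : A.card < n) :
    (∃! ν : ProbabilityMeasure ℝ, IsSelfSimilar A n (ν : Measure ℝ)) ∧
      ∀ ν : ProbabilityMeasure ℝ, IsSelfSimilar A n (ν : Measure ℝ) →
        ∀ (C : Finset ℕ) (p : ℕ → ℝ), (∀ c ∈ C, 0 < p c) → ∑ c ∈ C, p c = 1 →
          (∃ c ∈ C, ∃ c' ∈ C, p c ≠ p c') →
          IsProbabilityMeasure (Measure.conv (discreteMeasure C p) (ν : Measure ℝ)) ∧
          IsCompact (Measure.conv (discreteMeasure C p) (ν : Measure ℝ)).support ∧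
          IsSingularlyContinuous (Measure.conv (discreteMeasure C p) (ν : Measure ℝ)) ∧
          IsRSpectralMeasure (Measure.conv (discreteMeasure C p) (ν : Measure ℝ)) ∧
          ¬ IsSpectralMeasure (Measure.conv (discreteMeasure C p) (ν : Measure ℝ)) := by
  obtain ⟨h0A, h0B⟩ := hAB.zero_mem (by omega)
  have hA0 : A.Nonempty := ⟨0, h0A⟩
  have hA2 : 1 < A.card := by
    by_contra hc
    obtain ⟨a, rfl⟩ := Finset.card_eq_one.1 (le_antisymm (not_lt.1 hc) hA0.card_pos)
    rw [Finset.mem_singleton] at h0A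
    simp [← h0A] at hgcd
  have hn4 : 4 ≤ n := by
    have h1 := hAB.card_mul_card
    have h2 : 2 ≤ B.card := by
      by_contra hc
      have : A.card * B.card ≤ A.card * 1 := Nat.mul_le_mul_left _ (by omega)
      omega
    have := Nat.mul_le_mul (show 2 ≤ A.card by omega) h2
    omega
  have hlt : ∀ a ∈ A, a < n := fun a ha => (isDirectSumRange_iff.1 hAB).2.1 a ha 0 h0B
  have hn1 : 1 < n := by omega
  refine ⟨?_, fun ν hν C p hp hp1 hne => ?_⟩
  · obtain ⟨ν, hν, -⟩ := exists_isSelfSimilar hn1 hlt hA0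
    refine ⟨ν, hν, fun ν' (hν' : IsSelfSimilar A n (ν' : Measure ℝ)) => ?_⟩
    have h : (ν' : Measure ℝ) = ν := hν'.unique hn1 hν
    exact Subtype.ext h
  have hIcc := hν.measure_compl_Icc hn1 hlt hA0
  have hatom := hν.noAtoms hn1 hlt hA2
  have hIco : (ν : Measure ℝ) (Set.Ico 0 1)ᶜ = 0 := by
    refine measure_mono_null (t := (Set.Icc 0 1)ᶜ ∪ {1}) ?_ (measure_union_null hIcc (hatom 1))
    intro x hx
    by_cases h1 : x = 1
    · exact Or.inr h1
    · exact Or.inl fun h => hx ⟨h.1, lt_of_le_of_ne h.2 h1⟩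
  have := isProbabilityMeasure_discreteMeasure hp hp1
  obtain ⟨S₀, hS₀⟩ := hAB.exists_isDual (by omega)
  obtain ⟨S, hS, hSn⟩ := hS₀.exists_balanced (by omega) hA0
  exact ⟨inferInstance, isCompact_support_discreteMeasure_conv C p hIcc,
    isSingularlyContinuous_discreteMeasure_conv C p
      ⟨hatom, hν.mutuallySingular hn1 hlt hA0 hAn⟩,
    isRSpectralMeasure_discreteMeasure_conv hp (discreteMeasure_conv C p ν) hIco (digitUnion n S)
      (hS.exists_hilbertBasis hn4 hAB hSn hν),
    not_isSpectralMeasure_discreteMeasure_conv hp hne hIco⟩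

theorem mainTheorem3 :
    (∃ μ : ProbabilityMeasure ℝ,
      IsCompact (μ : Measure ℝ).support ∧ IsSingularlyContinuous (μ : Measure ℝ) ∧
      IsRSpectralMeasure (μ : Measure ℝ) ∧ ¬ IsSpectralMeasure (μ : Measure ℝ)) ∧
    ∀ (n : ℕ) (A B : Finset ℕ), IsDirectSumRange A B n → A.gcd id = 1 → A.card < n →
      (∃! ν : ProbabilityMeasure ℝ, IsSelfSimilar A n (ν : Measure ℝ)) ∧
      ∀ ν : ProbabilityMeasure ℝ, IsSelfSimilar A n (ν : Measure ℝ) →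
        ∀ (C : Finset ℕ) (p : ℕ → ℝ), (∀ c ∈ C, 0 < p c) → ∑ c ∈ C, p c = 1 →
          (∃ c ∈ C, ∃ c' ∈ C, p c ≠ p c') →
          IsProbabilityMeasure (Measure.conv (discreteMeasure C p) (ν : Measure ℝ)) ∧
          IsCompact (Measure.conv (discreteMeasure C p) (ν : Measure ℝ)).support ∧
          IsSingularlyContinuous (Measure.conv (discreteMeasure C p) (ν : Measure ℝ)) ∧
          IsRSpectralMeasure (Measure.conv (discreteMeasure C p) (ν : Measure ℝ)) ∧
          ¬ IsSpectralMeasure (Measure.conv (discreteMeasure C p) (ν : Measure ℝ)) := by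
  refine ⟨?_, fun n A B hAB hgcd hAn => discreteMeasure_conv_selfSimilar hAB hgcd hAn⟩
  -- `{0, 1} ⊕ {0, 2} = {0, 1, 2, 3}` and the weights `1 / 3`, `2 / 3` on `{0, 1}`
  have hAB : IsDirectSumRange {0, 1} {0, 2} 4 := by
    rw [isDirectSumRange_iff]
    decide
  obtain ⟨⟨ν, hν, -⟩, h⟩ := discreteMeasure_conv_selfSimilar hAB (by decide) (by decide)
  obtain ⟨h1, h2⟩ := h ν hν {0, 1} (fun c => if c = 0 then 1 / 3 else 2 / 3)
    (by intro c _; split_ifs <;> norm_num) (by norm_num)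
    ⟨0, by simp, 1, by simp, by norm_num⟩
  exact ⟨⟨_, h1⟩, h2⟩
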